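/- **Setting.** Let $F_1,\dots,F_N$ be contractive similarities of a Euclidean space and $K$ their invariant set, the nonempty compact set with $K=\bigcup_i F_iK$. For a word $w=(w_1,\dots,w_m)$ put $F_w=F_{w_1}\circ\cdots\circ F_{w_m}$. Assume that $K$ is connected and that there is a finite set $V_0=\{v_1,\dots,v_{N_0}\}\subset K$, $N_0\ge 2$, such that $F_wK\cap F_{w'}K\subset F_wV_0\cap F_{w'}V_0$, with $F_wK\cap F_{w'}K$ disjoint from $V_0$, for any two different words $w,w'$ of the same length; that each $v_j$ is the fixed point of exactly one map of the system, denoted $F_j$; and that $F_iK\cap F_{i'}K$ has at most one point for $i\ne i'$. Put $V_m=\bigcup_{|w|=m}F_wV_0$. The points of $V_*=\bigcup_m V_m$ are the vertices. A vertex that lies in two different cells $F_wK$, $F_{w'}K$ with $|w|=|w'|$ is called a junction vertex, any other a nonjunction vertex. Let a regular harmonic structure be given: conductances $c_{jl}=c_{lj}>0$ $(j\neq l)$ and factors $r_i\in(0,1)$ such that, with $\mathcal E_0(g)=\sum_{j<l}c_{jl}(g(v_j)-g(v_l))^2$ and $\mathcal E_m(g)=\sum_{|w|=m}r_w^{-1}\mathcal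 E_0(g\circ F_w)$, where $r_w=r_{w_1}\cdots r_{w_m}$, the number $\mathcal E_0(a)$ is the minimum of $\mathcal E_1(g)$ over all extensions $g$ of $a$, for every $a:V_0\to\mathbb R$. A continuous function on $K$ is harmonic if it minimizes every $\mathcal E_m$ for its values on $V_0$. Let $M_j$ be the matrix with $h(F_jv_k)=\sum_l (M_j)_{kl}h(v_l)$ for all harmonic $h$. Assume that each $M_j$ $(1\le j\le N_0)$ has a complete set of real left eigenvectors $\beta_{jk}$, $1\le k\le N_0$, with real nonzero eigenvalues $\lambda_{jk}$, labeled in decreasing order of absolute value. Then $\lambda_{j1}=1$, and $\lambda_{j2}=r_j$ is a simple eigenvalue; normalize $(\beta_{j2})_j=\sum_{i\ne j}c_{ij}$ and $(\beta_{j2})_l=-c_{lj}$ for $l\ne j$. Let $x$ be a vertex and let $n$ be the first number with $x\in V_n$. Let $C(x)$ be the set of pairs $(u,j)$ with $|u|=n$ and $F_uv_j=x$ (one pair if $x$ is a nonjunction vertex, at least two otherwise). Put $U_m(x)=\bigcup_{(u,j)\in C(x)}F_uF_j^mK$. The boundary points of $U_m(x)$ are the points $F_uF_j^mv_l$, $(u,j)\in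 C(x)$, $1\le l\le N_0$, with $x$ itself removed if $x$ is a junction vertex. A continuous function on $U_0(x)$ is harmonic on $U_0(x)$ if for every $m$ it minimizes $g\mapsto\sum_{(u,j)\in C(x)}r_u^{-1}\mathcal E_m(g\circ F_u)$ for its values at the boundary points of $U_0(x)$. The derivatives of a function $f$ at $x$ are the limits $$\lim_{m\to\infty}r_u^{-1}\lambda_{jk}^{-m}\sum_{l}(\beta_{jk})_l f(F_uF_j^mv_l),\qquad (u,j)\in C(x),\ 2\le k\le N_0,$$ and together they form the gradient of $f$ at $x$. A function $f:K\to\mathbb R$ that is continuous in a neighborhood of $x$ is differentiable at $x$ if all these limits exist and, if $x$ is a junction vertex, the sum over $(u,j)\in C(x)$ of those with $k=2$ is $0$. Its weak tangent $T_1^x(f)$ is the harmonic function on $U_0(x)$ with the same value and the same gradient at $x$ as $f$. Let $h_m$ be the harmonic function on $U_0(x)$ that has the same values as $f$ at the boundary points of $U_m(x)$. **Theorem.** Suppose that for every $j$ one of the following (equivalent) conditions holds: (a) $(\beta_{jk})_j=0$ for all $k\ge 3$; (b) the right eigenvector $\alpha_{j2}$ of $M_j$ for $\lambda_{j2}$ with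 $\beta_{j2}\alpha_{j2}=1$ satisfies $(\alpha_{j2})_l=c(1-\delta_{jl})$ for all $l$, for some constant $c\neq0$; (c) $(M_j)_{lj}=1-\lambda_{j2}+\lambda_{j2}\delta_{jl}$ for all $l$. Then for every vertex $x$ and every function $f$ that is differentiable at $x$, the functions $T_1^x(f)$ and $h_m$ $(m\ge0)$ exist, and $h_m$ converges to $T_1^x(f)$ uniformly on $U_0(x)$ as $m\to\infty$. -/

import Mathlib

open Filter Topology

noncomputable section

/-- A post-critically finite self-similar set `K` in `ℝ^d` with `N` similarities `F i` and
`N₀ = n + 2 ≥ 2` boundary points `v j`, satisfying the standing geometric assumptions.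
All indices start at `0`. The index of the map that the literature calls `F_j`, the one that fixes
the boundary point `v j`, is `idx j`. -/
structure PCFFractal (d N n : ℕ) where
  /-- the iterated function system -/
  F : Fin N → EuclideanSpace ℝ (Fin d) → EuclideanSpace ℝ (Fin d)
  /-- the invariant set -/
  K : Set (EuclideanSpace ℝ (Fin d))
  /-- the boundary points -/
  v : Fin (n + 2) → EuclideanSpace ℝ (Fin d)
  /-- `F (idx j)` is the map of the system with fixed point `v j` -/
  idx : Fin (n + 2) → Fin N
  similarity : ∀ i, ∃ ρ : ℝ, 0 < ρ ∧ ρ < 1 ∧ ∀ y z, dist (F i y) (F i z) = ρ * dist y z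
  isCompact : IsCompact K
  invariant : K = ⋃ i, F i '' K
  isConnected : IsConnected K
  v_injective : Function.Injective v
  v_mem : ∀ j, v j ∈ K
  /-- every boundary point is the fixed point of exactly one map of the system -/
  fixed_iff : ∀ j i, F i (v j) = v j ↔ i = idx j
  /-- two different cells of the first level have at most one common point -/
  subsingleton_inter : ∀ i i', i ≠ i' → (F i '' K ∩ F i' '' K).Subsingleton
  /-- Different cells of the same level meet only in points that are boundary points of both, and
  never in a point of `V_0`. (For a word `w` of length `m`, the map `F_w` is `F_{w_1} ∘ ⋯ ∘ F_{w_m}`,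
  written here as a right fold.) -/
  pcf : ∀ (m : ℕ) (w w' : Fin m → Fin N), w ≠ w' →
    (fun y => (List.ofFn w).foldr F y) '' K ∩ (fun y => (List.ofFn w').foldr F y) '' K ⊆
      ((fun y => (List.ofFn w).foldr F y) '' Set.range v ∩
        (fun y => (List.ofFn w').foldr F y) '' Set.range v) \ Set.range v

namespace PCFFractal

variable {d N n : ℕ} (S : PCFFractal d N n)

/-- `F_w = F_{w_1} ∘ ⋯ ∘ F_{w_m}` -/
def wordMap {m : ℕ} (w : Fin m → Fin N) (y : EuclideanSpace ℝ (Fin d)) :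
    EuclideanSpace ℝ (Fin d) :=
  (List.ofFn w).foldr S.F y

/-- `V_m`, the union of the sets `F_w V_0` over the words `w` of length `m` -/
def V (m : ℕ) : Set (EuclideanSpace ℝ (Fin d)) :=
  {x | ∃ (w : Fin m → Fin N) (j : Fin (n + 2)), S.wordMap w (S.v j) = x}

/-- the set `V_*` of all vertices -/
def Vstar : Set (EuclideanSpace ℝ (Fin d)) := ⋃ m, S.V m

/-- `x` lies in two different cells of the same level -/
def IsJunction (x : EuclideanSpace ℝ (Fin d)) : Prop :=
  ∃ (m : ℕ) (w w' : Fin m → Fin N), w ≠ w' ∧ x ∈ S.wordMap w '' S.K ∧ x ∈ S.wordMap w' '' S.K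

/-- the first `m` with `x ∈ V_m` -/
def level (x : EuclideanSpace ℝ (Fin d)) : ℕ := sInf {m | x ∈ S.V m}

open Classical in
/-- The pairs `(u, j)` with `F_u v_j = x`, where `u` runs over the words whose length is the
first `m` with `x ∈ V_m`.
For a nonjunction vertex there is exactly one such pair, `x = F_w v_j`. For a junction vertex `x`
these words `u` have a common prefix `w` of length `m - 1`, the last letters of the words `u` are
exactly the elements `j` of the set `J(x)`, and `x = F_w F_j v_{j'}` for the pairs `(w j, j')`. -/
def corners (x : EuclideanSpace ℝ (Fin d)) :
    Finset ((Fin (S.level x) → Fin N) × Fin (n + 2)) :=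
  Finset.univ.filter fun p => S.wordMap p.1 (S.v p.2) = x

/-- For a pair `p = (u, j)`, the map `F_u ∘ F_j^m`. -/
def cornerMap {k : ℕ} (p : (Fin k → Fin N) × Fin (n + 2)) (m : ℕ)
    (y : EuclideanSpace ℝ (Fin d)) : EuclideanSpace ℝ (Fin d) :=
  S.wordMap p.1 ((S.F (S.idx p.2))^[m] y)

/-- the standard system of neighborhoods: `U_m(x)` is `F_w F_j^m K` for a nonjunction vertex
and `⋃_{j ∈ J(x)} F_w F_j F_{j'}^m K` for a junction vertex -/
def U (x : EuclideanSpace ℝ (Fin d)) (m : ℕ) : Set (EuclideanSpace ℝ (Fin d)) :=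
  ⋃ p ∈ S.corners x, S.cornerMap p m '' S.K

/-- The boundary points of `U_m(x)`: the boundary points of its cells, except for `x` itself when
`x` is a junction vertex. (A nonjunction vertex `x` is a boundary point of `U_m(x)`.) -/
def bdryU (x : EuclideanSpace ℝ (Fin d)) (m : ℕ) : Set (EuclideanSpace ℝ (Fin d)) :=
  {y | (∃ p ∈ S.corners x, ∃ l, y = S.cornerMap p m (S.v l)) ∧ (S.IsJunction x → y ≠ x)}

end PCFFractal

/-- The form `∑_{j < l} c_{jl} (a_j - a_l)^2` on functions on `V_0`. -/
def graphForm {n : ℕ} (c : Fin (n + 2) → Fin (n + 2) → ℝ) (a : Fin (n + 2) → ℝ) : ℝ :=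
  ∑ j, ∑ l ∈ Finset.Ioi j, c j l * (a j - a l) ^ 2

/-- `𝓔_m(g) = ∑_{|w| = m} r_w⁻¹ 𝓔_0(g ∘ F_w)` for conductances `c` and factors `r` -/
def levelEnergy {d N n : ℕ} (S : PCFFractal d N n) (c : Fin (n + 2) → Fin (n + 2) → ℝ)
    (r : Fin N → ℝ) (m : ℕ) (g : EuclideanSpace ℝ (Fin d) → ℝ) : ℝ :=
  ∑ w : Fin m → Fin N, (∏ i, r (w i))⁻¹ * graphForm c fun j => g (S.wordMap w (S.v j))

/-- A regular harmonic structure on `K`: positive conductances `c` and renormalization factors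
`r i ∈ (0,1)` such that `𝓔_0(a)` is the minimum of `𝓔_1(g)` over all extensions `g` of `a`. -/
structure HarmonicStructure {d N n : ℕ} (S : PCFFractal d N n) where
  /-- the conductances; only the values off the diagonal are used -/
  c : Fin (n + 2) → Fin (n + 2) → ℝ
  /-- the renormalization factors -/
  r : Fin N → ℝ
  c_symm : ∀ j l, c j l = c l j
  c_pos : ∀ j l, j ≠ l → 0 < c j l
  r_pos : ∀ i, 0 < r i
  r_lt_one : ∀ i, r i < 1
  renormalization : ∀ a : Fin (n + 2) → ℝ,
    IsLeast {t | ∃ g : EuclideanSpace ℝ (Fin d) → ℝ,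
      (∀ j, g (S.v j) = a j) ∧ levelEnergy S c r 1 g = t} (graphForm c a)

namespace HarmonicStructure

variable {d N n : ℕ} {S : PCFFractal d N n} (H : HarmonicStructure S)

/-- `𝓔_m` -/
def energy (m : ℕ) (g : EuclideanSpace ℝ (Fin d) → ℝ) : ℝ := levelEnergy S H.c H.r m g

/-- `r_w = r_{w_1} ⋯ r_{w_m}` -/
def rWord {m : ℕ} (w : Fin m → Fin N) : ℝ := ∏ i, H.r (w i)

/-- `h` is harmonic on `K`: it is continuous on `K` and minimizes `𝓔_m`, for every `m`, among the
functions with the same values on `V_0`. Functions are given on the ambient space; only their values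
on `K` matter. -/
def IsHarmonic (h : EuclideanSpace ℝ (Fin d) → ℝ) : Prop :=
  ContinuousOn h S.K ∧
    ∀ (m : ℕ) (g : EuclideanSpace ℝ (Fin d) → ℝ), (∀ j, g (S.v j) = h (S.v j)) →
      H.energy m h ≤ H.energy m g

open Classical in
/-- the harmonic function on `K` with boundary values `a` -/
def harmonicExt (a : Fin (n + 2) → ℝ) : EuclideanSpace ℝ (Fin d) → ℝ :=
  if h : ∃ g, H.IsHarmonic g ∧ ∀ j, g (S.v j) = a j then h.choose else 0

/-- The matrix `M_j` that maps the values `h|_{V_0}` of a harmonic function to the values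
`h|_{F_j V_0}`; its column `l` belongs to the harmonic function that is `1` at `v l` and `0` at
the other boundary points. -/
def M (j : Fin (n + 2)) : Matrix (Fin (n + 2)) (Fin (n + 2)) ℝ :=
  Matrix.of fun k l => H.harmonicExt (Pi.single l 1) (S.F (S.idx j) (S.v k))

/-- the coefficient vector of the normal derivative at `v j` -/
def normalVec (j l : Fin (n + 2)) : ℝ :=
  if l = j then ∑ i ∈ Finset.univ.erase j, H.c i j else -H.c l j

/-- The part of the `m`-th energy that belongs to `U_0(x)`. -/
def energyU (x : EuclideanSpace ℝ (Fin d)) (m : ℕ) (g : EuclideanSpace ℝ (Fin d) → ℝ) : ℝ :=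
  ∑ p ∈ S.corners x, (H.rWord p.1)⁻¹ * H.energy m fun y => g (S.wordMap p.1 y)

/-- `h` is harmonic on `U_0(x)`: it is continuous there and minimizes the energy of `U_0(x)` at all
levels among the functions with the same values at the boundary points of `U_0(x)`. -/
def IsHarmonicOnU (x : EuclideanSpace ℝ (Fin d)) (h : EuclideanSpace ℝ (Fin d) → ℝ) : Prop :=
  ContinuousOn h (S.U x 0) ∧
    ∀ (m : ℕ) (g : EuclideanSpace ℝ (Fin d) → ℝ), (∀ y ∈ S.bdryU x 0, g y = h y) →
      H.energyU x m h ≤ H.energyU x m g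

/-- A function that is harmonic on `U_0(x)` and agrees with `f` at the boundary points of `U_m(x)`:
the approximant `h_m` of `f` at `x`. -/
def IsApproximant (f : EuclideanSpace ℝ (Fin d) → ℝ) (x : EuclideanSpace ℝ (Fin d)) (m : ℕ)
    (h : EuclideanSpace ℝ (Fin d) → ℝ) : Prop :=
  H.IsHarmonicOnU x h ∧ ∀ y ∈ S.bdryU x m, h y = f y

/-- For every `j`, a complete set of real left eigenvectors `β j k` of `M_j`, with real nonzero
eigenvalues `lam j k` in decreasing order of absolute value. The index `k` starts at `0`: `β j 0`
belongs to the eigenvalue `1`, and `β j 1` is normalized to be the coefficient vector of the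
normal derivative. -/
structure EigenSystem where
  β : Fin (n + 2) → Fin (n + 2) → Fin (n + 2) → ℝ
  lam : Fin (n + 2) → Fin (n + 2) → ℝ
  eigen : ∀ j k, Matrix.vecMul (β j k) (H.M j) = lam j k • β j k
  complete : ∀ j, LinearIndependent ℝ (β j)
  lam_ne_zero : ∀ j k, lam j k ≠ 0
  lam_order : ∀ j k l, k ≤ l → |lam j l| ≤ |lam j k|
  normal : ∀ j l, β j 1 l = H.normalVec j l

namespace EigenSystem

variable {H} (B : H.EigenSystem)

/-- `L` is the derivative of `f` at `x = F_u v_j` that belongs to the pair `p = (u, j)` and to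
the eigenvector `β j k`: the limit of `r_u⁻¹ λ_{jk}^{-m} β_{jk} f|_{F_u F_j^m V_0}`. -/
def HasVertexDeriv (f : EuclideanSpace ℝ (Fin d) → ℝ) {q : ℕ}
    (p : (Fin q → Fin N) × Fin (n + 2)) (k : Fin (n + 2)) (L : ℝ) : Prop :=
  Tendsto (fun m : ℕ => (H.rWord p.1)⁻¹ * (B.lam p.2 k ^ m)⁻¹ *
    ∑ l, B.β p.2 k l * f (S.cornerMap p m (S.v l))) atTop (𝓝 L)

/-- All the derivatives of `f` at `x` exist, and `D` is their collection (the gradient). The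
values `D p k` for `p` outside `corners x` or `k = 0` play no role. -/
def HasGradient (f : EuclideanSpace ℝ (Fin d) → ℝ) (x : EuclideanSpace ℝ (Fin d))
    (D : (Fin (S.level x) → Fin N) × Fin (n + 2) → Fin (n + 2) → ℝ) : Prop :=
  ∀ p ∈ S.corners x, ∀ k, k ≠ 0 → B.HasVertexDeriv f p k (D p k)

/-- `f` is differentiable at the vertex `x`: `f` is continuous on a neighborhood of `x` in `K`,
all its derivatives at `x` exist, and the compatibility condition holds if `x` is a junction
vertex. -/
def DifferentiableAtVertex (f : EuclideanSpace ℝ (Fin d) → ℝ)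
    (x : EuclideanSpace ℝ (Fin d)) : Prop :=
  (∃ W ∈ 𝓝 x, ContinuousOn f (W ∩ S.K)) ∧
    ∃ D, B.HasGradient f x D ∧ (S.IsJunction x → ∑ p ∈ S.corners x, D p 1 = 0)

/-- `T` is the weak tangent of order one of `f` at `x`: harmonic on `U_0(x)`, with the same value
and the same gradient at `x` as `f`. -/
def IsWeakTangent (f : EuclideanSpace ℝ (Fin d) → ℝ) (x : EuclideanSpace ℝ (Fin d))
    (T : EuclideanSpace ℝ (Fin d) → ℝ) : Prop :=
  H.IsHarmonicOnU x T ∧ T x = f x ∧ ∃ D, B.HasGradient f x D ∧ B.HasGradient T x D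

/-- `(β_{jk})_j = 0` for all eigenvectors after the second one -/
def CondA (j : Fin (n + 2)) : Prop := ∀ k, 1 < k → B.β j k j = 0

/-- The right eigenvector `α_{j2}` of `M_j` for the second eigenvalue, with `β_{j2} α_{j2} = 1`,
is a nonzero multiple of the vector `(1 - δ_{jl})_l`. (The second eigenvalue is simple, so that there
is exactly one such `α`.) -/
def CondB (j : Fin (n + 2)) : Prop :=
  ∃ α : Fin (n + 2) → ℝ, Matrix.mulVec (H.M j) α = B.lam j 1 • α ∧ ∑ l, B.β j 1 l * α l = 1 ∧
    ∃ c : ℝ, c ≠ 0 ∧ ∀ l, α l = c * (1 - if j = l then 1 else 0)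

/-- `(M_j)_{lj} = 1 - λ_{j2} + λ_{j2} δ_{jl}` -/
def CondC (j : Fin (n + 2)) : Prop :=
  ∀ l, H.M j l j = 1 - B.lam j 1 + B.lam j 1 * if j = l then 1 else 0

end EigenSystem

end HarmonicStructure

end

/-! Indices start at `0`, so `k = 1` is the normal derivative. A harmonic function on a cell is
determined by its values at the boundary points of the cell, and zooming in at `v j` acts on these
values by `M j`. In the coordinates given by the left eigenvectors `β j k` the zoom multiplies by
`lam j k`, so the difference quotients of a harmonic function at a corner do not depend on `m`
(`hasVertexDeriv_of_isHarmonic`). Value and gradient at `x` are therefore linear coordinates on the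
boundary data of each cell of `U_0(x)`. Harmonic pieces with a common value at `x` glue to a
harmonic function on `U_0(x)` exactly when, at a junction, the normal derivatives add up to `0`
(`isHarmonicOnU_iff`). This gives the weak tangent. It gives `h_m` as well: since no eigenvalue is
`0`, the zoom can be inverted, and the free value of `h_m` at a junction is fixed by the same
condition.

For convergence, put `s_m = h_m(x) - f(x)`. The `k`-th derivative of `h_m` at a corner is the `m`-th
difference quotient of `f` plus `s_m r_u⁻¹ λ_{jk}^{-m} (β_{jk})_j` (`coord_approximant`). For `k =
1` the weights multiplying `s_m` are positive. The derivatives of `h_m` add up to `0` over the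
corners and the quotients of `f` add up to something tending to `0`, so no cancellation is possible
and `s_m` times each weight tends to `0` (`tendsto_change_mul_weight`). As `0 < lam j 1 < 1`, also
`s_m → 0`. For `k ≥ 2` the factor `λ_{jk}^{-m}` may grow faster, and condition (a) removes the term.
All coordinates of `h_m` thus converge to those of the tangent, and the maximum principle makes the
convergence uniform.

Conditions (b) and (c) reduce to (a) in `condA_of_mulVec`, where simplicity of `lam j 1` comes from
a strong minimum principle. The existence of harmonic functions is proved by iterating the
minimization of `𝓔_1`. -/

namespace PCFFractal

/-! ### Geometry of cells and vertices. -/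

variable {d N n : ℕ} (S : PCFFractal d N n)

/-- The map `F_w` of a word `w`, given as a list. -/
def listMap (l : List (Fin N)) (y : EuclideanSpace ℝ (Fin d)) : EuclideanSpace ℝ (Fin d) :=
  l.foldr S.F y

@[simp] theorem listMap_nil (y : EuclideanSpace ℝ (Fin d)) : S.listMap [] y = y := rfl

@[simp] theorem listMap_cons (i : Fin N) (l : List (Fin N)) (y : EuclideanSpace ℝ (Fin d)) :
    S.listMap (i :: l) y = S.F i (S.listMap l y) := rfl

theorem listMap_append (l l' : List (Fin N)) (y : EuclideanSpace ℝ (Fin d)) :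
    S.listMap (l ++ l') y = S.listMap l (S.listMap l' y) := by
  simp [listMap]

theorem wordMap_eq {m : ℕ} (w : Fin m → Fin N) (y : EuclideanSpace ℝ (Fin d)) :
    S.wordMap w y = S.listMap (List.ofFn w) y := rfl

theorem wordMap_cons {m : ℕ} (i : Fin N) (w : Fin m → Fin N) (y : EuclideanSpace ℝ (Fin d)) :
    S.wordMap (Fin.cons i w) y = S.F i (S.wordMap w y) := by
  simp [wordMap_eq, List.ofFn_succ]

theorem F_injective (i : Fin N) : Function.Injective (S.F i) := by
  obtain ⟨ρ, h0, -, h⟩ := S.similarity i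
  intro y z hyz
  have := h y z
  rw [hyz, dist_self] at this
  have h2 : dist y z = 0 := by
    rcases mul_eq_zero.mp this.symm with h | h
    · exact absurd h h0.ne'
    · exact h
  exact dist_eq_zero.mp h2

theorem listMap_injective (l : List (Fin N)) : Function.Injective (S.listMap l) := by
  induction l with
  | nil => exact fun _ _ h => h
  | cons i l ih => exact (S.F_injective i).comp ih

theorem F_mem {i : Fin N} {y : EuclideanSpace ℝ (Fin d)} (hy : y ∈ S.K) : S.F i y ∈ S.K := by
  rw [S.invariant]
  exact Set.mem_iUnion.mpr ⟨i, y, hy, rfl⟩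

theorem listMap_mem (l : List (Fin N)) {y : EuclideanSpace ℝ (Fin d)} (hy : y ∈ S.K) :
    S.listMap l y ∈ S.K := by
  induction l with
  | nil => exact hy
  | cons i l ih => exact S.F_mem ih

theorem exists_listMap_eq (m : ℕ) {y : EuclideanSpace ℝ (Fin d)} (hy : y ∈ S.K) :
    ∃ l : List (Fin N), l.length = m ∧ ∃ z ∈ S.K, S.listMap l z = y := by
  induction m generalizing y with
  | zero => exact ⟨[], rfl, y, hy, rfl⟩
  | succ m ih =>
    rw [S.invariant] at hy
    obtain ⟨i, z, hz, rfl⟩ := Set.mem_iUnion.mp hy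
    obtain ⟨l, hl, z', hz', rfl⟩ := ih hz
    exact ⟨i :: l, by simp [hl], z', hz', rfl⟩

/-- Every word map scales distances by a positive constant. -/
theorem listMap_similarity (l : List (Fin N)) :
    ∃ ρ : ℝ, 0 < ρ ∧ ∀ y z, dist (S.listMap l y) (S.listMap l z) = ρ * dist y z := by
  induction l with
  | nil => exact ⟨1, one_pos, fun y z => by simp⟩
  | cons i l ih =>
    obtain ⟨ρ, h0, h⟩ := ih
    obtain ⟨ρ', h0', -, h'⟩ := S.similarity i
    exact ⟨ρ' * ρ, by positivity, fun y z => by simp [h, h', mul_assoc]⟩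

/-- The word maps contract uniformly. -/
theorem exists_contraction : ∃ ρ : ℝ, 0 ≤ ρ ∧ ρ < 1 ∧
    ∀ (l : List (Fin N)) y z, dist (S.listMap l y) (S.listMap l z) ≤ ρ ^ l.length * dist y z := by
  choose ρ h0 h1 h using S.similarity
  obtain ⟨σ, hσ0, hσ1, hσ⟩ : ∃ σ : ℝ, 0 ≤ σ ∧ σ < 1 ∧ ∀ i, ρ i ≤ σ := by
    rcases isEmpty_or_nonempty (Fin N) with hN | hN
    · exact ⟨0, le_rfl, one_pos, fun i => isEmptyElim i⟩
    · obtain ⟨i, hi⟩ := Finite.exists_max ρ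
      exact ⟨ρ i, (h0 i).le, h1 i, hi⟩
  refine ⟨σ, hσ0, hσ1, fun l => ?_⟩
  induction l with
  | nil => intro y z; simp
  | cons i l ih =>
    intro y z
    rw [listMap_cons, listMap_cons, h, List.length_cons, pow_succ', mul_assoc]
    exact mul_le_mul (hσ i) (ih y z) dist_nonneg hσ0

theorem listMap_continuous (l : List (Fin N)) : Continuous (S.listMap l) := by
  obtain ⟨ρ, h0, h⟩ := S.listMap_similarity l
  exact (LipschitzWith.of_dist_le_mul (K := ⟨ρ, h0.le⟩) fun y z => (h y z).le).continuous

theorem isClosed_cell (l : List (Fin N)) : IsClosed (S.listMap l '' S.K) :=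
  (S.isCompact.image (S.listMap_continuous l)).isClosed

/-- A point of two different cells of the same level is a boundary point of both, and not a point
of `V_0`. -/
theorem meet {l l' : List (Fin N)} (hlen : l.length = l'.length) (hne : l ≠ l')
    {y z : EuclideanSpace ℝ (Fin d)} (hy : y ∈ S.K) (hz : z ∈ S.K)
    (h : S.listMap l y = S.listMap l' z) :
    (∃ j, y = S.v j) ∧ (∃ j, z = S.v j) ∧ ∀ j, S.listMap l y ≠ S.v j := by
  have e : List.ofFn l.get = l := List.ofFn_get l
  have e' : List.ofFn (fun i : Fin l.length => l'.get (Fin.cast hlen i)) = l' := by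
    apply List.ext_get <;> simp [hlen]
  have key := @S.pcf l.length l.get (fun i => l'.get (Fin.cast hlen i))
    (fun hh => hne (by rw [← e, ← e', hh])) (S.listMap l y)
    ⟨⟨y, hy, by simp only [e]; rfl⟩, ⟨z, hz, by simp only [e']; exact h.symm⟩⟩
  simp only [e, e'] at key
  obtain ⟨⟨⟨_, ⟨j, rfl⟩, h1⟩, ⟨_, ⟨j', rfl⟩, h2⟩⟩, h3⟩ := key
  refine ⟨⟨j, (S.listMap_injective l h1).symm⟩, ⟨j', ?_⟩, fun k hk => h3 ⟨k, hk.symm⟩⟩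
  rw [h] at h2
  exact (S.listMap_injective l' h2).symm

theorem F_meet {i i' : Fin N} (hne : i ≠ i') {y z : EuclideanSpace ℝ (Fin d)} (hy : y ∈ S.K)
    (hz : z ∈ S.K) (h : S.F i y = S.F i' z) :
    (∃ j, y = S.v j) ∧ (∃ j, z = S.v j) ∧ ∀ j, S.F i y ≠ S.v j :=
  S.meet (l := [i]) (l' := [i']) rfl (by simpa using hne) hy hz h

@[simp] theorem F_idx_v (j : Fin (n + 2)) : S.F (S.idx j) (S.v j) = S.v j :=
  (S.fixed_iff j _).mpr rfl

@[simp] theorem listMap_replicate_v (m : ℕ) (j : Fin (n + 2)) :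
    S.listMap (List.replicate m (S.idx j)) (S.v j) = S.v j := by
  induction m with
  | zero => rfl
  | succ m ih => simp [List.replicate_succ, ih]

/-- The constant word of the same length fixes `v k`. A different word would make two cells meet at
a point of `V_0`, which `pcf` forbids. -/
theorem listMap_v_eq_v {l : List (Fin N)} {j k : Fin (n + 2)} (h : S.listMap l (S.v j) = S.v k) :
    l = List.replicate l.length (S.idx k) ∧ j = k := by
  have h1 : l = List.replicate l.length (S.idx k) := by
    by_contra hne
    refine (S.meet (by simp) hne (S.v_mem j) (S.v_mem k) ?_).2.2 k h
    rw [h, listMap_replicate_v]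
  refine ⟨h1, S.v_injective (S.listMap_injective l ?_)⟩
  rw [h, h1, listMap_replicate_v]

theorem F_v_eq_v {i : Fin N} {j k : Fin (n + 2)} (h : S.F i (S.v j) = S.v k) :
    i = S.idx k ∧ j = k := by
  have := S.listMap_v_eq_v (l := [i]) h
  simpa using this

/-- Points of `V_m`, in terms of lists. -/
theorem mem_V_iff {m : ℕ} {x : EuclideanSpace ℝ (Fin d)} :
    x ∈ S.V m ↔ ∃ l : List (Fin N), l.length = m ∧ ∃ j, S.listMap l (S.v j) = x := by
  constructor
  · rintro ⟨w, j, rfl⟩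
    exact ⟨List.ofFn w, by simp, j, rfl⟩
  · rintro ⟨l, rfl, j, rfl⟩
    exact ⟨l.get, j, by rw [wordMap_eq, List.ofFn_get]⟩

theorem mem_Vstar_iff {x : EuclideanSpace ℝ (Fin d)} :
    x ∈ S.Vstar ↔ ∃ l j, S.listMap l (S.v j) = x := by
  simp only [Vstar, Set.mem_iUnion, mem_V_iff]
  exact ⟨fun ⟨_, l, _, j, h⟩ => ⟨l, j, h⟩, fun ⟨l, j, h⟩ => ⟨_, l, rfl, j, h⟩⟩

theorem Vstar_subset : S.Vstar ⊆ S.K := fun _ hx => by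
  obtain ⟨l, j, rfl⟩ := S.mem_Vstar_iff.mp hx
  exact S.listMap_mem l (S.v_mem j)

/-- Every cell contains a vertex, and the diameters of the cells tend to `0` with the level. -/
theorem K_subset_closure_Vstar : S.K ⊆ closure S.Vstar := by
  intro x hx
  obtain ⟨ρ, h0, h1, hρ⟩ := S.exists_contraction
  obtain ⟨D, hD⟩ := Metric.isBounded_iff.mp S.isCompact.isBounded
  rw [Metric.mem_closure_iff]
  intro ε hε
  have ht : Tendsto (fun m => ρ ^ m * D) atTop (𝓝 (0 * D)) :=
    (tendsto_pow_atTop_nhds_zero_of_lt_one h0 h1).mul_const D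
  rw [zero_mul] at ht
  obtain ⟨m, hm⟩ := (ht.eventually (gt_mem_nhds hε)).exists
  obtain ⟨l, rfl, z, hz, rfl⟩ := S.exists_listMap_eq m hx
  refine ⟨S.listMap l (S.v 0), S.mem_Vstar_iff.mpr ⟨l, 0, rfl⟩, ?_⟩
  exact ((hρ l _ _).trans (mul_le_mul_of_nonneg_left (hD hz (S.v_mem 0)) (by positivity))).trans_lt
    hm

/-- Near `x`, only the cells of level `m` that contain `x` are met. -/
theorem eventually_common_cell (m : ℕ) (x : EuclideanSpace ℝ (Fin d)) :
    ∀ᶠ y in 𝓝 x, y ∈ S.K → ∃ l : List (Fin N), l.length = m ∧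
      x ∈ S.listMap l '' S.K ∧ y ∈ S.listMap l '' S.K := by
  let C : Set (EuclideanSpace ℝ (Fin d)) :=
    ⋃ w : {w : Fin m → Fin N // x ∉ S.listMap (List.ofFn w) '' S.K},
      S.listMap (List.ofFn w.1) '' S.K
  have hC : IsClosed C := isClosed_iUnion_of_finite fun w => S.isClosed_cell _
  have hx : x ∈ Cᶜ := by
    simp only [C, Set.mem_compl_iff, Set.mem_iUnion, not_exists]
    exact fun w => w.2
  filter_upwards [hC.isOpen_compl.mem_nhds hx] with y hy hyK
  obtain ⟨l, rfl, z, hz, rfl⟩ := S.exists_listMap_eq m hyK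
  refine ⟨l, rfl, ?_, z, hz, rfl⟩
  by_contra hxl
  refine hy (Set.mem_iUnion.mpr ⟨⟨l.get, ?_⟩, ?_⟩)
  · rwa [List.ofFn_get]
  · simp only [List.ofFn_get]
    exact ⟨z, hz, rfl⟩

/-- A vertex in the cell of `l` is `F_l` of a vertex. -/
theorem exists_vertex_of_mem_cell {l : List (Fin N)} {y : EuclideanSpace ℝ (Fin d)}
    (hy : y ∈ S.Vstar) (hyl : y ∈ S.listMap l '' S.K) :
    ∃ t j, S.listMap (l ++ t) (S.v j) = y := by
  obtain ⟨s, j, rfl⟩ := S.mem_Vstar_iff.mp hy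
  obtain ⟨z, hz, hzy⟩ := hyl
  -- Appending letters `idx j` does not move the point, and makes the word long enough for its
  -- beginning to be compared with `l`.
  set s' := s ++ List.replicate l.length (S.idx j) with hs'
  have h1 : S.listMap s' (S.v j) = S.listMap s (S.v j) := by
    rw [hs', listMap_append, listMap_replicate_v]
  have h2 : S.listMap s' (S.v j) =
      S.listMap (s'.take l.length) (S.listMap (s'.drop l.length) (S.v j)) := by
    rw [← listMap_append, List.take_append_drop]
  by_cases hl : l = s'.take l.length
  · refine ⟨s'.drop l.length, j, ?_⟩
    rw [← h1, h2, listMap_append, ← hl]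
  · have hlen : l.length = (s'.take l.length).length := by
      simp [hs']
    obtain ⟨⟨k, rfl⟩, -⟩ := S.meet hlen hl hz (S.listMap_mem _ (S.v_mem j))
      (hzy.trans (h1.symm.trans h2))
    exact ⟨[], k, by rw [List.append_nil, hzy]⟩

theorem exists_common_prefix {α : Type*} {l l' : List α} (hlen : l.length = l'.length)
    (hne : l ≠ l') :
    ∃ s a b t t', a ≠ b ∧ l = s ++ a :: t ∧ l' = s ++ b :: t' := by
  induction l generalizing l' with
  | nil => exact absurd (List.length_eq_zero_iff.mp hlen.symm).symm hne
  | cons a t ih =>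
    match l' with
    | [] => simp at hlen
    | b :: t' =>
      by_cases hab : a = b
      · subst hab
        obtain ⟨s, c, e, u, u', hce, h1, h2⟩ := ih (l' := t') (by simpa using hlen) (by simpa using hne)
        exact ⟨a :: s, c, e, u, u', hce, by simp [h1], by simp [h2]⟩
      · exact ⟨[], a, b, t, t', hab, rfl, rfl⟩

variable {S}

theorem mem_corners {x : EuclideanSpace ℝ (Fin d)}
    {p : (Fin (S.level x) → Fin N) × Fin (n + 2)} :
    p ∈ S.corners x ↔ S.wordMap p.1 (S.v p.2) = x := by
  simp [corners]

theorem corners_nonempty {x : EuclideanSpace ℝ (Fin d)} (hx : x ∈ S.Vstar) :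
    (S.corners x).Nonempty := by
  have : x ∈ S.V (S.level x) := Nat.sInf_mem (s := {m | x ∈ S.V m}) (Set.mem_iUnion.mp hx)
  obtain ⟨w, j, h⟩ := this
  exact ⟨(w, j), mem_corners.mpr h⟩

theorem wordMap_injective {m : ℕ} (w : Fin m → Fin N) : Function.Injective (S.wordMap w) :=
  S.listMap_injective _

theorem fst_ne_of_ne {x : EuclideanSpace ℝ (Fin d)}
    {p q : (Fin (S.level x) → Fin N) × Fin (n + 2)} (hp : p ∈ S.corners x) (hq : q ∈ S.corners x)
    (hne : p ≠ q) : p.1 ≠ q.1 := by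
  intro h
  rw [mem_corners] at hp hq
  refine hne (Prod.ext h (S.v_injective (wordMap_injective (S := S) p.1 ?_)))
  rw [h] at hp ⊢
  exact hp.trans hq.symm

/-- Two different cells of `U_0(x)` meet only at `x`. -/
theorem eq_of_mem_two_cells {x : EuclideanSpace ℝ (Fin d)}
    {p q : (Fin (S.level x) → Fin N) × Fin (n + 2)} (hp : p ∈ S.corners x) (hq : q ∈ S.corners x)
    (hne : p ≠ q) {y z : EuclideanSpace ℝ (Fin d)} (hy : y ∈ S.K) (hz : z ∈ S.K)
    (h : S.wordMap p.1 y = S.wordMap q.1 z) : S.wordMap p.1 y = x := by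
  have hpq : List.ofFn p.1 ≠ List.ofFn q.1 :=
    fun h => fst_ne_of_ne hp hq hne (List.ofFn_injective h)
  -- Once the common prefix is cancelled, both the common point and `x` come from the intersection
  -- of two different first-level cells, which has at most one point.
  obtain ⟨s, a, b, t, t', hab, h1, h2⟩ := exists_common_prefix (by simp) hpq
  rw [mem_corners] at hp hq
  have hx := hp.trans hq.symm
  simp only [wordMap_eq, h1, h2, listMap_append, listMap_cons] at h hx
  have h3 := S.listMap_injective s h
  have h4 := S.listMap_injective s hx
  have hsub := S.subsingleton_inter a b hab
    ⟨⟨_, S.listMap_mem t hy, rfl⟩, ⟨_, S.listMap_mem t' hz, h3.symm⟩⟩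
    ⟨⟨_, S.listMap_mem t (S.v_mem p.2), rfl⟩, ⟨_, S.listMap_mem t' (S.v_mem q.2), h4.symm⟩⟩
  refine Eq.trans ?_ hp
  rw [wordMap_eq, wordMap_eq, h1, listMap_append, listMap_append, listMap_cons, listMap_cons,
    hsub]

end PCFFractal

/-! ### Energy forms and their monotonicity in the level. -/

noncomputable section

/-- The bilinear form of `graphForm`. -/
def graphBilin {n : ℕ} (c : Fin (n + 2) → Fin (n + 2) → ℝ) (a b : Fin (n + 2) → ℝ) : ℝ :=
  ∑ j, ∑ l ∈ Finset.Ioi j, c j l * (a j - a l) * (b j - b l)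

theorem graphForm_add_mul {n : ℕ} (c : Fin (n + 2) → Fin (n + 2) → ℝ) (a b : Fin (n + 2) → ℝ)
    (t : ℝ) : graphForm c (fun j => a j + t * b j) =
      graphForm c a + 2 * t * graphBilin c a b + t ^ 2 * graphForm c b := by
  simp only [graphForm, graphBilin, Finset.mul_sum, ← Finset.sum_add_distrib]
  refine Finset.sum_congr rfl fun j _ => Finset.sum_congr rfl fun l _ => ?_
  ring

theorem two_mul_sum_Ioi {ι : Type*} [Fintype ι] [LinearOrder ι] [LocallyFiniteOrderTop ι]
    (G : ι → ι → ℝ) (hs : ∀ i j, G i j = G j i)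
    (h0 : ∀ i, G i i = 0) : 2 * ∑ i, ∑ j ∈ Finset.Ioi i, G i j = ∑ i, ∑ j, G i j := by
  have h1 : ∑ i, ∑ j ∈ Finset.Ioi i, G i j =
      ∑ j, ∑ i ∈ Finset.univ.filter (· < j), G i j := by
    refine Finset.sum_comm' fun i j => ?_
    simp
  have h2 : ∀ i, ∑ j, G i j = ∑ j ∈ Finset.Ioi i, G i j +
      ∑ j ∈ Finset.univ.filter (· < i), G j i := by
    intro i
    have h3 : ∑ j ∈ Finset.univ.filter (· < i), G j i =
        ∑ j ∈ Finset.univ.filter (¬ i < ·), G i j := by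
      refine Finset.sum_subset_zero_on_sdiff (fun j => ?_) (fun j hj => ?_) (fun j _ => hs j i)
      · simpa using le_of_lt
      · simp only [Finset.mem_sdiff, Finset.mem_filter, Finset.mem_univ, true_and, not_lt] at hj
        rw [le_antisymm hj.1 hj.2, h0]
    rw [h3, ← Finset.sum_filter_add_sum_filter_not Finset.univ (i < ·)]
    congr 1
    refine Finset.sum_congr ?_ fun _ _ => rfl
    ext j
    simp
  rw [Finset.sum_congr rfl fun i _ => h2 i, Finset.sum_add_distrib, ← h1]
  ring

/-- The first-order condition at a minimum. The value `t = -b / (|q| + 1)` is small enough for the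
linear term to dominate whatever `q` is. -/
theorem eq_zero_of_quadratic_nonneg {b q : ℝ} (h : ∀ t : ℝ, 0 ≤ 2 * t * b + t ^ 2 * q) : b = 0 := by
  by_contra hb
  have hb2 : 0 < b ^ 2 := by positivity
  have hq : 0 < |q| + 1 := by positivity
  have h1 := h (-b / (|q| + 1))
  have h2 : 2 * (-b / (|q| + 1)) * b + (-b / (|q| + 1)) ^ 2 * q =
      b ^ 2 * (q - 2 * (|q| + 1)) / (|q| + 1) ^ 2 := by
    field_simp
    ring
  rw [h2] at h1
  have h3 : b ^ 2 * (q - 2 * (|q| + 1)) / (|q| + 1) ^ 2 < 0 := by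
    apply div_neg_of_neg_of_pos _ (by positivity)
    apply mul_neg_of_pos_of_neg hb2
    linarith [le_abs_self q, abs_nonneg q]
  linarith

namespace HarmonicStructure

variable {d N n : ℕ} {S : PCFFractal d N n} (H : HarmonicStructure S)

theorem graphForm_nonneg (a : Fin (n + 2) → ℝ) : 0 ≤ graphForm H.c a :=
  Finset.sum_nonneg fun j _ => Finset.sum_nonneg fun l hl =>
    mul_nonneg (H.c_pos j l (Finset.mem_Ioi.mp hl).ne).le (sq_nonneg _)

theorem mul_sq_le_graphForm (a : Fin (n + 2) → ℝ) (j l : Fin (n + 2)) (hjl : j ≠ l) :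
    H.c j l * (a j - a l) ^ 2 ≤ graphForm H.c a := by
  wlog h : j < l generalizing j l
  · have := this l j hjl.symm (lt_of_le_of_ne (not_lt.mp h) hjl.symm)
    rw [H.c_symm] at this
    linarith
  · have hn : ∀ j, ∀ l ∈ Finset.Ioi j, 0 ≤ H.c j l * (a j - a l) ^ 2 := fun j l hl =>
      mul_nonneg (H.c_pos j l (Finset.mem_Ioi.mp hl).ne).le (sq_nonneg _)
    exact (Finset.single_le_sum (f := fun l => H.c j l * (a j - a l) ^ 2) (hn j)
      (Finset.mem_Ioi.mpr h)).trans (Finset.single_le_sum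
        (f := fun j => ∑ l ∈ Finset.Ioi j, H.c j l * (a j - a l) ^ 2)
        (fun j _ => Finset.sum_nonneg (hn j)) (Finset.mem_univ j))

theorem eq_of_graphForm_eq_zero {a : Fin (n + 2) → ℝ} (h : graphForm H.c a = 0)
    (j l : Fin (n + 2)) : a j = a l := by
  by_cases hjl : j = l
  · rw [hjl]
  · have h1 := H.mul_sq_le_graphForm a j l hjl
    have h2 := H.c_pos j l hjl
    rw [h] at h1
    have h3 : (a j - a l) ^ 2 = 0 := le_antisymm (by nlinarith) (sq_nonneg _)
    exact sub_eq_zero.mp (pow_eq_zero_iff two_ne_zero |>.mp h3)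

/-- The oscillation on `V_0` is controlled by the energy. -/
theorem exists_osc_le : ∃ C : ℝ, 0 ≤ C ∧ ∀ (a : Fin (n + 2) → ℝ) (j l : Fin (n + 2)),
    |a j - a l| ≤ C * √(graphForm H.c a) := by
  obtain ⟨p, hp⟩ := Finite.exists_max fun p : Fin (n + 2) × Fin (n + 2) => (H.c p.1 p.2)⁻¹
  refine ⟨√ |(H.c p.1 p.2)⁻¹|, Real.sqrt_nonneg _, fun a j l => ?_⟩
  rw [← Real.sqrt_mul (abs_nonneg _)]
  apply Real.abs_le_sqrt
  by_cases hjl : j = l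
  · rw [hjl, sub_self, zero_pow two_ne_zero]
    exact mul_nonneg (abs_nonneg _) (H.graphForm_nonneg a)
  · have h1 := H.mul_sq_le_graphForm a j l hjl
    have h2 := H.c_pos j l hjl
    have h3 : (H.c j l)⁻¹ ≤ |(H.c p.1 p.2)⁻¹| := (hp (j, l)).trans (le_abs_self _)
    calc (a j - a l) ^ 2 = (H.c j l)⁻¹ * (H.c j l * (a j - a l) ^ 2) := by
          field_simp
      _ ≤ |(H.c p.1 p.2)⁻¹| * graphForm H.c a :=
          mul_le_mul h3 h1 (by positivity) (abs_nonneg _)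

theorem normalVec_sum (j : Fin (n + 2)) (a : Fin (n + 2) → ℝ) :
    ∑ l, H.normalVec j l * a l = ∑ l ∈ Finset.univ.erase j, H.c j l * (a j - a l) := by
  rw [← Finset.add_sum_erase _ _ (Finset.mem_univ j)]
  have h : ∑ l ∈ Finset.univ.erase j, H.normalVec j l * a l =
      ∑ l ∈ Finset.univ.erase j, -H.c l j * a l :=
    Finset.sum_congr rfl fun l hl => by simp [normalVec, Finset.ne_of_mem_erase hl]
  rw [h, normalVec, if_pos rfl, Finset.sum_mul, ← Finset.sum_add_distrib]
  exact Finset.sum_congr rfl fun l _ => by rw [H.c_symm l j]; ring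

/-- Summation by parts: testing the form with the indicator of `v j` produces the normal derivative
there. -/
theorem graphBilin_single (a : Fin (n + 2) → ℝ) (j : Fin (n + 2)) :
    graphBilin H.c a (Pi.single j 1) = ∑ l, H.normalVec j l * a l := by
  set e : Fin (n + 2) → ℝ := Pi.single j 1 with he
  have h1 := two_mul_sum_Ioi (fun i l => H.c i l * (a i - a l) * (e i - e l))
    (fun i l => by rw [H.c_symm i l]; ring) (fun i => by ring)
  have h2 : ∑ i, ∑ l, H.c i l * (a i - a l) * (e i - e l) =
      ∑ i, ∑ l, H.c i l * (a i - a l) * e i + ∑ l, ∑ i, H.c i l * (a l - a i) * e l := by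
    rw [Finset.sum_comm (f := fun l i => H.c i l * (a l - a i) * e l)]
    simp only [← Finset.sum_add_distrib]
    exact Finset.sum_congr rfl fun i _ => Finset.sum_congr rfl fun l _ => by ring
  have h3 : ∀ g : Fin (n + 2) → Fin (n + 2) → ℝ,
      ∑ i, ∑ l, g i l * e i = ∑ l, g j l := by
    intro g
    simp only [← Finset.sum_mul]
    simp [he, Pi.single_apply]
  rw [h2, h3, h3 (fun l i => H.c i l * (a l - a i))] at h1
  rw [normalVec_sum]
  simp only [H.c_symm _ j] at h1
  simp only [graphBilin]
  have h4 : ∑ l ∈ Finset.univ.erase j, H.c j l * (a j - a l) = ∑ l, H.c j l * (a j - a l) :=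
    Finset.sum_erase _ (by simp)
  linarith

theorem normalVec_self_pos (j : Fin (n + 2)) : 0 < H.normalVec j j := by
  rw [normalVec, if_pos rfl]
  refine Finset.sum_pos (fun i hi => H.c_pos i j (Finset.ne_of_mem_erase hi)) ?_
  obtain ⟨i, hi⟩ := exists_ne j
  exact ⟨i, Finset.mem_erase.mpr ⟨hi, Finset.mem_univ i⟩⟩

/-- The bilinear form of `energy`. -/
def energyBilin (m : ℕ) (g φ : EuclideanSpace ℝ (Fin d) → ℝ) : ℝ :=
  ∑ w : Fin m → Fin N, (∏ i, H.r (w i))⁻¹ *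
    graphBilin H.c (fun j => g (S.wordMap w (S.v j))) fun j => φ (S.wordMap w (S.v j))

theorem energy_add_mul (m : ℕ) (g φ : EuclideanSpace ℝ (Fin d) → ℝ) (t : ℝ) :
    H.energy m (fun y => g y + t * φ y) =
      H.energy m g + 2 * t * H.energyBilin m g φ + t ^ 2 * H.energy m φ := by
  simp only [energy, levelEnergy, energyBilin, graphForm_add_mul, Finset.mul_sum,
    ← Finset.sum_add_distrib]
  exact Finset.sum_congr rfl fun w _ => by ring

theorem energy_zero (g : EuclideanSpace ℝ (Fin d) → ℝ) :
    H.energy 0 g = graphForm H.c fun j => g (S.v j) := by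
  simp [energy, levelEnergy, PCFFractal.wordMap_eq]

theorem energyBilin_zero (g φ : EuclideanSpace ℝ (Fin d) → ℝ) :
    H.energyBilin 0 g φ = graphBilin H.c (fun j => g (S.v j)) fun j => φ (S.v j) := by
  simp [energyBilin, PCFFractal.wordMap_eq]

theorem sum_words_succ {m : ℕ} (G : (Fin (m + 1) → Fin N) → ℝ) :
    ∑ w, G w = ∑ i, ∑ w : Fin m → Fin N, G (Fin.cons i w) := by
  rw [← Fintype.sum_prod_type']
  exact (Fintype.sum_equiv (Fin.consEquiv fun _ => Fin N) _ _ fun p => rfl).symm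

theorem energy_succ (m : ℕ) (g : EuclideanSpace ℝ (Fin d) → ℝ) :
    H.energy (m + 1) g = ∑ i, (H.r i)⁻¹ * H.energy m fun y => g (S.F i y) := by
  simp only [energy, levelEnergy, sum_words_succ, Finset.mul_sum, PCFFractal.wordMap_cons,
    Fin.prod_univ_succ, Fin.cons_zero, Fin.cons_succ, mul_inv, mul_assoc]

theorem energyBilin_succ (m : ℕ) (g φ : EuclideanSpace ℝ (Fin d) → ℝ) :
    H.energyBilin (m + 1) g φ =
      ∑ i, (H.r i)⁻¹ * H.energyBilin m (fun y => g (S.F i y)) fun y => φ (S.F i y) := by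
  simp only [energyBilin, sum_words_succ, Finset.mul_sum, PCFFractal.wordMap_cons,
    Fin.prod_univ_succ, Fin.cons_zero, Fin.cons_succ, mul_inv, mul_assoc]

theorem energy_nonneg (m : ℕ) (g : EuclideanSpace ℝ (Fin d) → ℝ) : 0 ≤ H.energy m g :=
  Finset.sum_nonneg fun _ _ => mul_nonneg
    (inv_nonneg.mpr (Finset.prod_nonneg fun _ _ => (H.r_pos _).le)) (H.graphForm_nonneg _)

theorem energy_zero_le_one (g : EuclideanSpace ℝ (Fin d) → ℝ) : H.energy 0 g ≤ H.energy 1 g := by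
  rw [energy_zero]
  exact (H.renormalization _).2 ⟨g, fun _ => rfl, rfl⟩

theorem inv_r_pos (i : Fin N) : 0 < (H.r i)⁻¹ := inv_pos.mpr (H.r_pos i)

/-- The inequality `𝓔_0 ≤ 𝓔_1` is applied inside the cells and summed. -/
theorem energy_one_le_succ (m : ℕ) (g : EuclideanSpace ℝ (Fin d) → ℝ) :
    H.energy 1 g ≤ H.energy (m + 1) g := by
  induction m generalizing g with
  | zero => exact le_rfl
  | succ m ih =>
    rw [H.energy_succ 0, H.energy_succ (m + 1)]
    exact Finset.sum_le_sum fun i _ => mul_le_mul_of_nonneg_left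
      ((H.energy_zero_le_one _).trans (ih _)) (H.inv_r_pos i).le

theorem energy_zero_le (m : ℕ) (g : EuclideanSpace ℝ (Fin d) → ℝ) :
    H.energy 0 g ≤ H.energy m g := by
  cases m with
  | zero => exact le_rfl
  | succ m => exact (H.energy_zero_le_one g).trans (H.energy_one_le_succ m g)

/-- Where `𝓔_m = 𝓔_0`, the bilinear forms agree as well. -/
theorem energyBilin_eq {m : ℕ} {g : EuclideanSpace ℝ (Fin d) → ℝ}
    (h : H.energy m g = H.energy 0 g) (φ : EuclideanSpace ℝ (Fin d) → ℝ) :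
    H.energyBilin m g φ = H.energyBilin 0 g φ := by
  -- `𝓔_m - 𝓔_0` is a nonnegative quadratic form that vanishes at `g`, hence `g` lies in its kernel.
  refine sub_eq_zero.mp (eq_zero_of_quadratic_nonneg (q := H.energy m φ - H.energy 0 φ) fun t => ?_)
  have h1 := H.energy_zero_le m fun y => g y + t * φ y
  rw [energy_add_mul, energy_add_mul, h] at h1
  linarith

theorem energy_eq_add_mul {m : ℕ} {g φ : EuclideanSpace ℝ (Fin d) → ℝ}
    (hg : H.energy m g = H.energy 0 g) (hφ : H.energy m φ = H.energy 0 φ) (t : ℝ) :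
    H.energy m (fun y => g y + t * φ y) = H.energy 0 fun y => g y + t * φ y := by
  rw [energy_add_mul, energy_add_mul, hg, hφ, H.energyBilin_eq hg]

/-- The inequality `𝓔_0 ≤ 𝓔_m` holds in each first-level cell, so equality of the weighted sums
forces equality in every cell. -/
theorem energy_comp_eq {m : ℕ} {g : EuclideanSpace ℝ (Fin d) → ℝ}
    (h : H.energy (m + 1) g = H.energy 0 g) (i : Fin N) :
    H.energy m (fun y => g (S.F i y)) = H.energy 0 fun y => g (S.F i y) := by
  have h1 : H.energy (m + 1) g = H.energy 1 g :=
    le_antisymm (h.le.trans (H.energy_zero_le_one g)) (H.energy_one_le_succ m g)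
  rw [H.energy_succ m, H.energy_succ 0] at h1
  have h2 := (Finset.sum_eq_sum_iff_of_le fun i _ => mul_le_mul_of_nonneg_left
    (H.energy_zero_le m fun y => g (S.F i y)) (H.inv_r_pos i).le).mp h1.symm i (Finset.mem_univ i)
  exact (mul_left_cancel₀ (H.inv_r_pos i).ne' h2).symm

end HarmonicStructure


/-! ### Minimizers of `𝓔_1`: uniqueness and maximum principles. -/

namespace HarmonicStructure

variable {d N n : ℕ} {S : PCFFractal d N n} (H : HarmonicStructure S)

/-- A function of zero energy on `V_1` is constant, because `K` is connected. -/
theorem eq_zero_of_energy_one_eq_zero {g : EuclideanSpace ℝ (Fin d) → ℝ} (h : H.energy 1 g = 0)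
    (h0 : ∀ j, g (S.v j) = 0) (i : Fin N) (j : Fin (n + 2)) : g (S.F i (S.v j)) = 0 := by
  have hconst : ∀ i j l, g (S.F i (S.v j)) = g (S.F i (S.v l)) := by
    intro i j l
    rw [H.energy_succ 0] at h
    have h1 := (Finset.sum_eq_zero_iff_of_nonneg fun i _ => mul_nonneg (H.inv_r_pos i).le
      (H.energy_nonneg 0 fun y => g (S.F i y))).mp h i (Finset.mem_univ i)
    rw [mul_eq_zero, or_iff_right (H.inv_r_pos i).ne', energy_zero] at h1
    exact H.eq_of_graphForm_eq_zero h1 j l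
  -- `g` is constant on the corners of each first-level cell. The cells where it is zero and those
  -- where it is not form two closed sets covering `K`. By connectedness they meet, and they do so
  -- at a corner of both, a contradiction.
  let A : Set (EuclideanSpace ℝ (Fin d)) :=
    ⋃ i : {i // g (S.F i (S.v 0)) = 0}, S.F i.1 '' S.K
  let B : Set (EuclideanSpace ℝ (Fin d)) :=
    ⋃ i : {i // ¬ g (S.F i (S.v 0)) = 0}, S.F i.1 '' S.K
  have hA : IsClosed A := isClosed_iUnion_of_finite fun i => S.isClosed_cell [i.1]
  have hB : IsClosed B := isClosed_iUnion_of_finite fun i => S.isClosed_cell [i.1]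
  have hK : S.K ⊆ A ∪ B := by
    intro y hy
    rw [S.invariant] at hy
    obtain ⟨i, hi⟩ := Set.mem_iUnion.mp hy
    by_cases hg : g (S.F i (S.v 0)) = 0
    · exact Or.inl (Set.mem_iUnion.mpr ⟨⟨i, hg⟩, hi⟩)
    · exact Or.inr (Set.mem_iUnion.mpr ⟨⟨i, hg⟩, hi⟩)
  rw [hconst i j 0]
  by_contra hi
  have hconn := isPreconnected_closed_iff.mp S.isConnected.isPreconnected A B hA hB hK
    ⟨S.v 0, S.v_mem 0, Set.mem_iUnion.mpr ⟨⟨S.idx 0, by rw [S.F_idx_v, h0]⟩, S.v 0, S.v_mem 0,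
      S.F_idx_v 0⟩⟩
    ⟨S.F i (S.v 0), S.F_mem (S.v_mem 0), Set.mem_iUnion.mpr ⟨⟨i, hi⟩, S.v 0, S.v_mem 0, rfl⟩⟩
  obtain ⟨y, -, hyA, hyB⟩ := hconn
  obtain ⟨⟨i1, h1⟩, z1, hz1, hy1⟩ := Set.mem_iUnion.mp hyA
  obtain ⟨⟨i2, h2⟩, z2, hz2, hy2⟩ := Set.mem_iUnion.mp hyB
  have hne : i1 ≠ i2 := by
    rintro rfl
    exact h2 h1
  obtain ⟨⟨k1, rfl⟩, ⟨k2, rfl⟩, -⟩ := S.F_meet hne hz1 hz2 (hy1.trans hy2.symm)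
  apply h2
  rw [hconst i2 0 k2, show S.F i2 (S.v k2) = S.F i1 (S.v k1) from hy2.trans hy1.symm,
    hconst i1 k1 0, h1]

/-- Minimizers of `𝓔_1` are determined on `V_1` by their values on `V_0`. -/
theorem level_one_unique {g g' : EuclideanSpace ℝ (Fin d) → ℝ}
    (hg : H.energy 1 g = H.energy 0 g) (hg' : H.energy 1 g' = H.energy 0 g')
    (h : ∀ j, g (S.v j) = g' (S.v j)) (i : Fin N) (j : Fin (n + 2)) :
    g (S.F i (S.v j)) = g' (S.F i (S.v j)) := by
  have h1 := H.energy_eq_add_mul hg hg' (-1)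
  have h2 : H.energy 0 (fun y => g y + -1 * g' y) = 0 := by
    simp [energy_zero, h, graphForm]
  have h3 := H.eq_zero_of_energy_one_eq_zero (h1.trans h2) (fun j => by simp [h]) i j
  linarith

/-- The maximum principle. -/
theorem level_one_mem_Icc {g : EuclideanSpace ℝ (Fin d) → ℝ}
    (hg : H.energy 1 g = H.energy 0 g) {s t : ℝ} (h : ∀ j, g (S.v j) ∈ Set.Icc s t)
    (i : Fin N) (j : Fin (n + 2)) : g (S.F i (S.v j)) ∈ Set.Icc s t := by
  -- Truncation to `[s, t]` keeps the values on `V_0` and does not raise the energy, so by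
  -- uniqueness it agrees with `g` on `V_1`.
  set g' : EuclideanSpace ℝ (Fin d) → ℝ := fun y => max s (min t (g y)) with hg'
  have hst : s ≤ t := (h 0).1.trans (h 0).2
  have heq : ∀ j, g (S.v j) = g' (S.v j) := fun j => by
    rw [hg']
    simp only
    rw [min_eq_right (h j).2, max_eq_right (h j).1]
  have h0 : H.energy 0 g = H.energy 0 g' := by
    simp only [energy_zero, heq]
  have hlip : ∀ y z, (g' y - g' z) ^ 2 ≤ (g y - g z) ^ 2 := by
    intro y z
    rw [sq_le_sq]
    calc |g' y - g' z| ≤ max |s - s| |min t (g y) - min t (g z)| :=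
          abs_max_sub_max_le_max _ _ _ _
      _ ≤ max |s - s| (max |t - t| |g y - g z|) :=
          max_le_max le_rfl (abs_min_sub_min_le_max _ _ _ _)
      _ = |g y - g z| := by simp
  have h1 : H.energy 1 g' ≤ H.energy 1 g := by
    refine Finset.sum_le_sum fun w _ => mul_le_mul_of_nonneg_left ?_
      (inv_nonneg.mpr (Finset.prod_nonneg fun i _ => (H.r_pos (w i)).le))
    exact Finset.sum_le_sum fun j _ => Finset.sum_le_sum fun l hl =>
      mul_le_mul_of_nonneg_left (hlip _ _) (H.c_pos j l (Finset.mem_Ioi.mp hl).ne).le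
  have h2 : H.energy 1 g' = H.energy 0 g' :=
    le_antisymm (by rw [← h0, ← hg]; exact h1) (H.energy_zero_le_one g')
  rw [H.level_one_unique hg h2 heq i j]
  exact ⟨le_max_left _ _, max_le hst (min_le_left _ _)⟩

/-- The strong minimum principle in a cell of the first level. -/
theorem level_one_eq_zero_of_interior_zero {g : EuclideanSpace ℝ (Fin d) → ℝ}
    (hg : H.energy 1 g = H.energy 0 g) (h : ∀ j, 0 ≤ g (S.v j)) {i : Fin N} {k : Fin (n + 2)}
    (hk : ∀ j, S.F i (S.v k) ≠ S.v j) (h0 : g (S.F i (S.v k)) = 0) (l : Fin (n + 2)) :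
    g (S.F i (S.v l)) = 0 := by
  classical
  obtain ⟨t, ht⟩ := Finite.exists_max fun j => g (S.v j)
  have hpos : ∀ i j, 0 ≤ g (S.F i (S.v j)) := fun i j =>
    (H.level_one_mem_Icc hg (fun j => ⟨h j, ht j⟩) i j).1
  -- Testing with the indicator of the zero expresses equilibrium there. Each cell through this
  -- point contributes a nonpositive amount and the total is `0`, so all neighbors of the point
  -- vanish.
  set φ : EuclideanSpace ℝ (Fin d) → ℝ := Pi.single (S.F i (S.v k)) 1 with hφ
  have hsingle : ∀ i' k', S.F i' (S.v k') = S.F i (S.v k) →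
      (fun j => φ (S.F i' (S.v j))) = Pi.single k' 1 := by
    intro i' k' h'
    ext j
    simp only [hφ, ← h', Pi.single_apply, (S.F_injective i').eq_iff, S.v_injective.eq_iff]
  have hterm : ∀ i' k', S.F i' (S.v k') = S.F i (S.v k) →
      graphBilin H.c (fun j => g (S.F i' (S.v j))) (fun j => φ (S.F i' (S.v j))) =
        -∑ l ∈ Finset.univ.erase k', H.c k' l * g (S.F i' (S.v l)) := by
    intro i' k' h'
    rw [hsingle i' k' h', H.graphBilin_single, H.normalVec_sum, ← Finset.sum_neg_distrib]
    refine Finset.sum_congr rfl fun l _ => ?_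
    rw [h', h0]
    ring
  have hnn : ∀ i' k', ∀ l ∈ Finset.univ.erase k', 0 ≤ H.c k' l * g (S.F i' (S.v l)) :=
    fun i' k' l hl => mul_nonneg (H.c_pos _ _ (Finset.ne_of_mem_erase hl).symm).le (hpos i' l)
  have hle : ∀ i', (H.r i')⁻¹ * H.energyBilin 0 (fun y => g (S.F i' y))
      (fun y => φ (S.F i' y)) ≤ 0 := by
    intro i'
    rw [energyBilin_zero]
    refine mul_nonpos_of_nonneg_of_nonpos (H.inv_r_pos i').le ?_
    by_cases h' : ∃ k', S.F i' (S.v k') = S.F i (S.v k)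
    · obtain ⟨k', h'⟩ := h'
      rw [hterm i' k' h']
      exact neg_nonpos.mpr (Finset.sum_nonneg (hnn i' k'))
    · have : ∀ j, φ (S.F i' (S.v j)) = 0 := fun j =>
        Pi.single_eq_of_ne (fun hh => h' ⟨j, hh⟩) _
      simp [graphBilin, this]
  have hB := H.energyBilin_eq hg φ
  have hφ0 : ∀ j, φ (S.v j) = 0 := fun j => Pi.single_eq_of_ne (hk j).symm _
  rw [H.energyBilin_succ 0, H.energyBilin_zero g φ] at hB
  have hB0 : graphBilin H.c (fun j => g (S.v j)) (fun j => φ (S.v j)) = 0 := by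
    simp [graphBilin, hφ0]
  rw [hB0] at hB
  have hi := (Finset.sum_eq_zero_iff_of_nonpos fun i' _ => hle i').mp hB i (Finset.mem_univ i)
  rw [mul_eq_zero, or_iff_right (H.inv_r_pos i).ne', energyBilin_zero, hterm i k rfl,
    neg_eq_zero, Finset.sum_eq_zero_iff_of_nonneg (hnn i k)] at hi
  by_cases hlk : l = k
  · rw [hlk, h0]
  · have := hi l (Finset.mem_erase.mpr ⟨hlk, Finset.mem_univ l⟩)
    rwa [mul_eq_zero, or_iff_right (H.c_pos _ _ (Ne.symm hlk)).ne'] at this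

theorem exists_level_one (a : Fin (n + 2) → ℝ) : ∃ g : EuclideanSpace ℝ (Fin d) → ℝ,
    (∀ j, g (S.v j) = a j) ∧ H.energy 1 g = H.energy 0 g := by
  obtain ⟨g, hg, h⟩ := (H.renormalization a).1
  refine ⟨g, hg, ?_⟩
  simp only [energy_zero, hg]
  exact h

/-- A minimizer of `𝓔_1` with values `a` on `V_0`. -/
def levelOne (a : Fin (n + 2) → ℝ) : EuclideanSpace ℝ (Fin d) → ℝ :=
  (H.exists_level_one a).choose

theorem levelOne_v (a : Fin (n + 2) → ℝ) (j : Fin (n + 2)) : H.levelOne a (S.v j) = a j :=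
  (H.exists_level_one a).choose_spec.1 j

theorem energy_levelOne (a : Fin (n + 2) → ℝ) :
    H.energy 1 (H.levelOne a) = H.energy 0 (H.levelOne a) :=
  (H.exists_level_one a).choose_spec.2

/-- The values at `F_i V_0` of the minimizer of `𝓔_1` with values `a` on `V_0`. -/
def step (i : Fin N) (a : Fin (n + 2) → ℝ) (j : Fin (n + 2)) : ℝ :=
  H.levelOne a (S.F i (S.v j))

theorem eq_step {g : EuclideanSpace ℝ (Fin d) → ℝ} (hg : H.energy 1 g = H.energy 0 g)
    (i : Fin N) (j : Fin (n + 2)) : g (S.F i (S.v j)) = H.step i (fun j => g (S.v j)) j :=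
  H.level_one_unique hg (H.energy_levelOne _) (fun j => (H.levelOne_v (fun j => g (S.v j)) j).symm) i j

theorem step_eq_step {i i' : Fin N} {j j' : Fin (n + 2)} (h : S.F i (S.v j) = S.F i' (S.v j'))
    (a : Fin (n + 2) → ℝ) : H.step i a j = H.step i' a j' := by
  simp only [step, h]

theorem step_idx (a : Fin (n + 2) → ℝ) (j : Fin (n + 2)) : H.step (S.idx j) a j = a j := by
  rw [step, S.F_idx_v, levelOne_v]

theorem step_mem_Icc {a : Fin (n + 2) → ℝ} {s t : ℝ} (h : ∀ j, a j ∈ Set.Icc s t) (i : Fin N)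
    (j : Fin (n + 2)) : H.step i a j ∈ Set.Icc s t :=
  H.level_one_mem_Icc (H.energy_levelOne a) (fun j => by rw [H.levelOne_v]; exact h j) i j

theorem sum_graphForm_step (a : Fin (n + 2) → ℝ) :
    ∑ i, (H.r i)⁻¹ * graphForm H.c (H.step i a) = graphForm H.c a := by
  have h2 := H.energy_levelOne a
  rw [H.energy_succ 0] at h2
  simp only [energy_zero, levelOne_v] at h2
  exact h2

end HarmonicStructure


/-! ### Construction of harmonic functions from their boundary values. -/

namespace HarmonicStructure

variable {d N n : ℕ} {S : PCFFractal d N n} (H : HarmonicStructure S)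

/-- The values at `F_l V_0` of the harmonic function with values `a` on `V_0`. -/
def cellValues : List (Fin N) → (Fin (n + 2) → ℝ) → Fin (n + 2) → ℝ
  | [], a => a
  | i :: l, a => cellValues l (H.step i a)

@[simp] theorem cellValues_nil (a : Fin (n + 2) → ℝ) : H.cellValues [] a = a := rfl

@[simp] theorem cellValues_cons (i : Fin N) (l : List (Fin N)) (a : Fin (n + 2) → ℝ) :
    H.cellValues (i :: l) a = H.cellValues l (H.step i a) := rfl

theorem cellValues_append (l l' : List (Fin N)) (a : Fin (n + 2) → ℝ) :
    H.cellValues (l ++ l') a = H.cellValues l' (H.cellValues l a) := by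
  induction l generalizing a with
  | nil => rfl
  | cons i l ih => exact ih _

theorem cellValues_replicate (m : ℕ) (a : Fin (n + 2) → ℝ) (j : Fin (n + 2)) :
    H.cellValues (List.replicate m (S.idx j)) a j = a j := by
  induction m generalizing a with
  | zero => rfl
  | succ m ih => rw [List.replicate_succ, cellValues_cons, ih, step_idx]

theorem cellValues_mem_Icc (l : List (Fin N)) {a : Fin (n + 2) → ℝ} {s t : ℝ}
    (h : ∀ j, a j ∈ Set.Icc s t) (j : Fin (n + 2)) : H.cellValues l a j ∈ Set.Icc s t := by
  induction l generalizing a with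
  | nil => exact h j
  | cons i l ih => exact ih fun j => H.step_mem_Icc h i j

/-- The energies of the first-level cells, weighted by `(r i)⁻¹`, add up to the total, so one cell
carries at most `r i` of it. Here `ρ` is the largest `r i`, below `1` by regularity. -/
theorem exists_graphForm_cellValues_le : ∃ ρ : ℝ, 0 ≤ ρ ∧ ρ < 1 ∧
    ∀ (l : List (Fin N)) (a : Fin (n + 2) → ℝ),
      graphForm H.c (H.cellValues l a) ≤ ρ ^ l.length * graphForm H.c a := by
  obtain ⟨i₀, hi₀⟩ : ∃ i₀, ∀ i, H.r i ≤ H.r i₀ := by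
    have : Nonempty (Fin N) := ⟨S.idx 0⟩
    exact Finite.exists_max H.r
  refine ⟨H.r i₀, (H.r_pos i₀).le, H.r_lt_one i₀, fun l => ?_⟩
  induction l with
  | nil => intro a; simp
  | cons i l ih =>
    intro a
    refine (ih _).trans ?_
    rw [List.length_cons, pow_succ, mul_assoc]
    refine mul_le_mul_of_nonneg_left ?_ (pow_nonneg (H.r_pos i₀).le _)
    have h1 : (H.r i)⁻¹ * graphForm H.c (H.step i a) ≤ graphForm H.c a := by
      rw [← H.sum_graphForm_step a]
      exact Finset.single_le_sum (f := fun i => (H.r i)⁻¹ * graphForm H.c (H.step i a))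
        (fun i _ => mul_nonneg (H.inv_r_pos i).le (H.graphForm_nonneg _)) (Finset.mem_univ i)
    calc graphForm H.c (H.step i a) = H.r i * ((H.r i)⁻¹ * graphForm H.c (H.step i a)) := by
          rw [mul_inv_cancel_left₀ (H.r_pos i).ne']
      _ ≤ H.r i₀ * graphForm H.c a := mul_le_mul (hi₀ i) h1
          (mul_nonneg (H.inv_r_pos i).le (H.graphForm_nonneg _)) (H.r_pos i₀).le

/-- Where the words first differ, the common point is a corner of both first-level subcells. The
remaining letters are then constant and do not change the value, which is that of a single minimizer
of `𝓔_1`. -/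
theorem cellValues_eq_of_length_eq {l l' : List (Fin N)} {j j' : Fin (n + 2)}
    (hlen : l.length = l'.length) (h : S.listMap l (S.v j) = S.listMap l' (S.v j'))
    (a : Fin (n + 2) → ℝ) : H.cellValues l a j = H.cellValues l' a j' := by
  induction l generalizing l' a with
  | nil =>
    obtain rfl := List.length_eq_zero_iff.mp hlen.symm
    rw [S.v_injective h]
  | cons i t ih =>
    match l' with
    | [] => simp at hlen
    | i' :: t' =>
      by_cases hi : i = i'
      · subst hi
        exact ih (by simpa using hlen) (S.F_injective i h) _
      · obtain ⟨⟨k, hk⟩, ⟨k', hk'⟩, -⟩ := S.F_meet hi (S.listMap_mem t (S.v_mem j))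
          (S.listMap_mem t' (S.v_mem j')) h
        obtain ⟨ht, rfl⟩ := S.listMap_v_eq_v hk
        obtain ⟨ht', rfl⟩ := S.listMap_v_eq_v hk'
        rw [cellValues_cons, cellValues_cons, ht, ht', cellValues_replicate, cellValues_replicate]
        refine H.step_eq_step ?_ a
        rw [PCFFractal.listMap_cons, PCFFractal.listMap_cons, hk, hk'] at h
        exact h

/-- The values on the cells fit together to a function on the vertices. -/
theorem cellValues_eq {l l' : List (Fin N)} {j j' : Fin (n + 2)}
    (h : S.listMap l (S.v j) = S.listMap l' (S.v j'))
    (a : Fin (n + 2) → ℝ) : H.cellValues l a j = H.cellValues l' a j' := by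
  -- Padding each word with its own fixing letter equalizes the lengths and changes neither points
  -- nor values.
  have h1 := H.cellValues_eq_of_length_eq (l := l ++ List.replicate l'.length (S.idx j))
    (l' := l' ++ List.replicate l.length (S.idx j')) (j := j) (j' := j')
    (by simp [add_comm]) (by simpa [S.listMap_append] using h) a
  simpa [cellValues_append, cellValues_replicate] using h1

/-- The function on the vertices with the values `cellValues`. -/
def vertexValue (a : Fin (n + 2) → ℝ) (y : EuclideanSpace ℝ (Fin d)) : ℝ :=
  open Classical in
  if h : ∃ p : List (Fin N) × Fin (n + 2), S.listMap p.1 (S.v p.2) = y then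
    H.cellValues h.choose.1 a h.choose.2 else 0

theorem vertexValue_listMap (a : Fin (n + 2) → ℝ) (l : List (Fin N)) (j : Fin (n + 2)) :
    H.vertexValue a (S.listMap l (S.v j)) = H.cellValues l a j := by
  have h : ∃ p : List (Fin N) × Fin (n + 2), S.listMap p.1 (S.v p.2) = S.listMap l (S.v j) :=
    ⟨(l, j), rfl⟩
  rw [vertexValue, dif_pos h]
  exact H.cellValues_eq h.choose_spec a

/-- Vertices of a common cell of high level have close values. -/
theorem exists_osc_vertexValue (a : Fin (n + 2) → ℝ) {ε : ℝ} (hε : 0 < ε) :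
    ∃ m, ∀ l : List (Fin N), l.length = m → ∀ y ∈ S.Vstar, ∀ z ∈ S.Vstar,
      y ∈ S.listMap l '' S.K → z ∈ S.listMap l '' S.K →
        |H.vertexValue a y - H.vertexValue a z| ≤ ε := by
  obtain ⟨ρ, h0, h1, hρ⟩ := H.exists_graphForm_cellValues_le
  obtain ⟨C, hC0, hC⟩ := H.exists_osc_le
  have ht : Tendsto (fun m => C * √(ρ ^ m * graphForm H.c a)) atTop
      (𝓝 (C * √(0 * graphForm H.c a))) :=
    ((tendsto_pow_atTop_nhds_zero_of_lt_one h0 h1).mul_const _).sqrt.const_mul C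
  rw [zero_mul, Real.sqrt_zero, mul_zero] at ht
  obtain ⟨m, hm⟩ := (ht.eventually (gt_mem_nhds hε)).exists
  refine ⟨m, fun l hl y hy z hz hyl hzl => ?_⟩
  obtain ⟨t, j, rfl⟩ := S.exists_vertex_of_mem_cell hy hyl
  obtain ⟨t', j', rfl⟩ := S.exists_vertex_of_mem_cell hz hzl
  rw [vertexValue_listMap, vertexValue_listMap, cellValues_append, cellValues_append]
  -- By the maximum principle all vertex values in the cell lie between the extreme values at its
  -- corners, and their difference is controlled by the decaying energy.
  obtain ⟨p, hp⟩ := Finite.exists_min (H.cellValues l a)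
  obtain ⟨q, hq⟩ := Finite.exists_max (H.cellValues l a)
  have hi := H.cellValues_mem_Icc t (fun j => ⟨hp j, hq j⟩) j
  have hi' := H.cellValues_mem_Icc t' (fun j => ⟨hp j, hq j⟩) j'
  refine (abs_sub_le_of_le_of_le hi.1 hi.2 hi'.1 hi'.2).trans ?_
  refine ((le_abs_self _).trans (hC _ q p)).trans (le_trans ?_ hm.le)
  exact mul_le_mul_of_nonneg_left (Real.sqrt_le_sqrt (hl ▸ hρ l a)) hC0

/-- A Cauchy argument. Vertices near `x` lie in small cells containing `x`. If two of them lie in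
different cells, then `x` is a vertex and their values are compared through the value at `x`. -/
theorem exists_tendsto_vertexValue (a : Fin (n + 2) → ℝ) {x : EuclideanSpace ℝ (Fin d)}
    (hx : x ∈ S.K) : ∃ t, Tendsto (H.vertexValue a) (𝓝[S.Vstar] x) (𝓝 t) := by
  have : (𝓝[S.Vstar] x).NeBot := mem_closure_iff_nhdsWithin_neBot.mp (S.K_subset_closure_Vstar hx)
  rw [← cauchy_map_iff_exists_tendsto, Metric.cauchy_iff]
  refine ⟨inferInstance, fun ε hε => ?_⟩
  obtain ⟨m, hm⟩ := H.exists_osc_vertexValue a (show 0 < ε / 4 by positivity)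
  refine ⟨H.vertexValue a '' {y | y ∈ S.Vstar ∧ ∃ l : List (Fin N), l.length = m ∧
    x ∈ S.listMap l '' S.K ∧ y ∈ S.listMap l '' S.K}, image_mem_map ?_, ?_⟩
  · filter_upwards [self_mem_nhdsWithin, nhdsWithin_le_nhds (S.eventually_common_cell m x)]
      with y hy h using ⟨hy, h (S.Vstar_subset hy)⟩
  · rintro _ ⟨y, ⟨hy, l, hl, hxl, hyl⟩, rfl⟩ _ ⟨z, ⟨hz, l', hl', hxl', hzl'⟩, rfl⟩
    rw [Real.dist_eq]
    by_cases hll : l = l'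
    · subst hll
      exact (hm l hl y hy z hz hyl hzl').trans_lt (by linarith)
    · obtain ⟨p, hp, hpx⟩ := hxl
      obtain ⟨q, hq, hqx⟩ := hxl'
      obtain ⟨⟨k, rfl⟩, -⟩ := S.meet (hl.trans hl'.symm) hll hp hq (hpx.trans hqx.symm)
      have hxV : x ∈ S.Vstar := S.mem_Vstar_iff.mpr ⟨l, k, hpx⟩
      have h1 := hm l hl y hy x hxV hyl ⟨_, hp, hpx⟩
      have h2 := hm l' hl' x hxV z hz ⟨_, hq, hqx⟩ hzl'
      have h3 := abs_sub_le (H.vertexValue a y) (H.vertexValue a x) (H.vertexValue a z)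
      linarith

/-- The vertex values extend by limits along the dense set `Vstar`. The limit at a vertex is the
prescribed value, because the vertex itself belongs to `Vstar`. -/
theorem exists_continuousOn_cellValues (a : Fin (n + 2) → ℝ) :
    ∃ h : EuclideanSpace ℝ (Fin d) → ℝ, ContinuousOn h S.K ∧
      ∀ l j, h (S.listMap l (S.v j)) = H.cellValues l a j := by
  refine ⟨extendFrom S.Vstar (H.vertexValue a), continuousOn_extendFrom S.K_subset_closure_Vstar
    fun x hx => H.exists_tendsto_vertexValue a hx, fun l j => ?_⟩
  have hV : S.listMap l (S.v j) ∈ S.Vstar := S.mem_Vstar_iff.mpr ⟨l, j, rfl⟩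
  obtain ⟨t, ht⟩ := H.exists_tendsto_vertexValue a (S.Vstar_subset hV)
  rw [extendFrom_eq (subset_closure hV) ht, ← vertexValue_listMap]
  exact (tendsto_nhds_unique (tendsto_pure_nhds _ _)
    (ht.mono_left (pure_le_nhdsWithin hV))).symm

theorem energy_eq_of_cellValues {h : EuclideanSpace ℝ (Fin d) → ℝ} {a : Fin (n + 2) → ℝ}
    (hh : ∀ l j, h (S.listMap l (S.v j)) = H.cellValues l a j) (m : ℕ) :
    H.energy m h = graphForm H.c a := by
  induction m generalizing h a with
  | zero => simp only [energy_zero, show ∀ j, h (S.v j) = a j from hh []]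
  | succ m ih =>
    rw [H.energy_succ, ← H.sum_graphForm_step a]
    exact Finset.sum_congr rfl fun i _ => by rw [ih fun l j => hh (i :: l) j]

theorem eq_cellValues {h : EuclideanSpace ℝ (Fin d) → ℝ}
    (hh : ∀ m, H.energy m h = H.energy 0 h) (l : List (Fin N)) (j : Fin (n + 2)) :
    h (S.listMap l (S.v j)) = H.cellValues l (fun j => h (S.v j)) j := by
  induction l generalizing h with
  | nil => rfl
  | cons i l ih =>
    rw [PCFFractal.listMap_cons, ih (h := fun y => h (S.F i y))
      fun m => H.energy_comp_eq (hh (m + 1)) i, cellValues_cons]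
    congr 1
    exact funext fun j => H.eq_step (hh 1) i j

theorem exists_isHarmonic (a : Fin (n + 2) → ℝ) :
    ∃ h, H.IsHarmonic h ∧ ∀ j, h (S.v j) = a j := by
  obtain ⟨h, hc, hh⟩ := H.exists_continuousOn_cellValues a
  have h0 : ∀ j, h (S.v j) = a j := hh []
  refine ⟨h, ⟨hc, fun m g hg => ?_⟩, h0⟩
  rw [H.energy_eq_of_cellValues hh m, show a = fun j => g (S.v j) from
    funext fun j => by rw [hg, h0], ← energy_zero]
  exact H.energy_zero_le m g

/-- Equality of energies, unlike minimality, passes at once to cells and to linear combinations. -/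
theorem isHarmonic_iff {h : EuclideanSpace ℝ (Fin d) → ℝ} :
    H.IsHarmonic h ↔ ContinuousOn h S.K ∧ ∀ m, H.energy m h = H.energy 0 h := by
  refine and_congr_right fun _ => ⟨fun hh m => ?_, fun hh m g hg => ?_⟩
  · obtain ⟨g, hgc, hg⟩ := H.exists_continuousOn_cellValues fun j => h (S.v j)
    refine le_antisymm ((hh m g (hg [])).trans_eq ?_) (H.energy_zero_le m h)
    rw [H.energy_eq_of_cellValues hg, energy_zero]
  · rw [hh m]
    refine le_trans (le_of_eq ?_) (H.energy_zero_le m g)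
    simp only [energy_zero, hg]

variable {H}

theorem IsHarmonic.energy_eq {h : EuclideanSpace ℝ (Fin d) → ℝ} (hh : H.IsHarmonic h) (m : ℕ) :
    H.energy m h = H.energy 0 h :=
  (H.isHarmonic_iff.mp hh).2 m

theorem IsHarmonic.comp_F {h : EuclideanSpace ℝ (Fin d) → ℝ} (hh : H.IsHarmonic h) (i : Fin N) :
    H.IsHarmonic fun y => h (S.F i y) :=
  H.isHarmonic_iff.mpr ⟨hh.1.comp (S.listMap_continuous [i]).continuousOn fun _ hy => S.F_mem hy,
    fun m => H.energy_comp_eq (hh.energy_eq (m + 1)) i⟩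

theorem IsHarmonic.add_mul {h h' : EuclideanSpace ℝ (Fin d) → ℝ} (hh : H.IsHarmonic h)
    (hh' : H.IsHarmonic h') (t : ℝ) : H.IsHarmonic fun y => h y + t * h' y :=
  H.isHarmonic_iff.mpr ⟨hh.1.add (continuousOn_const.mul hh'.1),
    fun m => H.energy_eq_add_mul (hh.energy_eq m) (hh'.energy_eq m) t⟩

theorem isHarmonic_const (t : ℝ) : H.IsHarmonic fun _ => t :=
  H.isHarmonic_iff.mpr ⟨continuousOn_const, fun m => by simp [energy, levelEnergy, graphForm]⟩

theorem IsHarmonic.eqOn {h h' : EuclideanSpace ℝ (Fin d) → ℝ} (hh : H.IsHarmonic h)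
    (hh' : H.IsHarmonic h') (h0 : ∀ j, h (S.v j) = h' (S.v j)) : Set.EqOn h h' S.K := by
  refine Set.EqOn.of_subset_closure (s := S.Vstar) (fun y hy => ?_) hh.1 hh'.1 S.Vstar_subset
    S.K_subset_closure_Vstar
  obtain ⟨l, j, rfl⟩ := S.mem_Vstar_iff.mp hy
  rw [H.eq_cellValues hh.energy_eq, H.eq_cellValues hh'.energy_eq, funext h0]

variable (H)

theorem harmonicExt_spec (a : Fin (n + 2) → ℝ) :
    H.IsHarmonic (H.harmonicExt a) ∧ ∀ j, H.harmonicExt a (S.v j) = a j := by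
  have h := H.exists_isHarmonic a
  rw [harmonicExt, dif_pos h]
  exact h.choose_spec

theorem harmonicExt_eqOn {h : EuclideanSpace ℝ (Fin d) → ℝ} (hh : H.IsHarmonic h) :
    Set.EqOn (H.harmonicExt fun j => h (S.v j)) h S.K :=
  (H.harmonicExt_spec _).1.eqOn hh (H.harmonicExt_spec _).2

/-- A harmonic function is the combination of the basic ones. -/
theorem harmonicExt_eq_sum (a : Fin (n + 2) → ℝ) {y : EuclideanSpace ℝ (Fin d)} (hy : y ∈ S.K) :
    H.harmonicExt a y = ∑ l, a l * H.harmonicExt (Pi.single l 1) y := by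
  have key : ∀ s : Finset (Fin (n + 2)),
      H.IsHarmonic fun y => ∑ l ∈ s, a l * H.harmonicExt (Pi.single l 1) y := by
    intro s
    induction s using Finset.induction_on with
    | empty => simpa using isHarmonic_const 0
    | insert l s hl ih =>
      have := ih.add_mul (H.harmonicExt_spec (Pi.single l 1)).1 (a l)
      simpa only [Finset.sum_insert hl, add_comm] using this
  refine (H.harmonicExt_spec a).1.eqOn (key Finset.univ) (fun j => ?_) hy
  rw [(H.harmonicExt_spec a).2]
  simp only [(H.harmonicExt_spec _).2]
  simp [Pi.single_apply]

/-- Harmonic functions are controlled by their boundary values. -/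
theorem abs_harmonicExt_le (a : Fin (n + 2) → ℝ) {y : EuclideanSpace ℝ (Fin d)} (hy : y ∈ S.K) :
    |H.harmonicExt a y| ≤ ∑ l, |a l| := by
  have hb : ∀ j, a j ∈ Set.Icc (-∑ l, |a l|) (∑ l, |a l|) := fun j =>
    abs_le.mp (Finset.single_le_sum (f := fun l => |a l|) (fun l _ => abs_nonneg _)
      (Finset.mem_univ j))
  obtain ⟨hh, h0⟩ := H.harmonicExt_spec a
  have hsub : H.harmonicExt a '' closure S.Vstar ⊆ Set.Icc (-∑ l, |a l|) (∑ l, |a l|) := by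
    have hcl : closure S.Vstar = S.K := (closure_minimal S.Vstar_subset
      S.isCompact.isClosed).antisymm S.K_subset_closure_Vstar
    refine (ContinuousOn.image_closure (hcl ▸ hh.1)).trans (closure_minimal ?_ isClosed_Icc)
    rintro _ ⟨z, hz, rfl⟩
    obtain ⟨l, j, rfl⟩ := S.mem_Vstar_iff.mp hz
    rw [H.eq_cellValues hh.energy_eq, funext h0]
    exact H.cellValues_mem_Icc l hb j
  exact abs_le.mpr (hsub ⟨y, S.K_subset_closure_Vstar hy, rfl⟩)

end HarmonicStructure


/-! ### Zooming in at a boundary point, and the left eigenvectors. -/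

namespace PCFFractal

variable {d N n : ℕ} (S : PCFFractal d N n)

theorem idx_injective : Function.Injective S.idx := by
  intro i j h
  obtain ⟨ρ, -, h1, hρ⟩ := S.similarity (S.idx i)
  have h2 := hρ (S.v i) (S.v j)
  rw [S.F_idx_v, h, S.F_idx_v] at h2
  refine S.v_injective (dist_eq_zero.mp (le_antisymm ?_ dist_nonneg))
  nlinarith [dist_nonneg (x := S.v i) (y := S.v j)]

theorem iterate_F (i : Fin N) (m : ℕ) (y : EuclideanSpace ℝ (Fin d)) :
    (S.F i)^[m] y = S.listMap (List.replicate m i) y := by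
  induction m with
  | zero => rfl
  | succ m ih => rw [Function.iterate_succ_apply', ih, List.replicate_succ, listMap_cons]

theorem iterate_F_mem (i : Fin N) (m : ℕ) {y : EuclideanSpace ℝ (Fin d)} (hy : y ∈ S.K) :
    (S.F i)^[m] y ∈ S.K := by
  rw [iterate_F]
  exact S.listMap_mem _ hy

@[simp] theorem iterate_F_idx_v (j : Fin (n + 2)) (m : ℕ) :
    (S.F (S.idx j))^[m] (S.v j) = S.v j := by
  rw [iterate_F, listMap_replicate_v]

theorem tendsto_iterate_F (j : Fin (n + 2)) (y : EuclideanSpace ℝ (Fin d)) :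
    Tendsto (fun m => (S.F (S.idx j))^[m] y) atTop (𝓝 (S.v j)) := by
  obtain ⟨ρ, h0, h1, hρ⟩ := S.exists_contraction
  rw [tendsto_iff_dist_tendsto_zero]
  have ht : Tendsto (fun m => ρ ^ m * dist y (S.v j)) atTop (𝓝 (0 * dist y (S.v j))) :=
    (tendsto_pow_atTop_nhds_zero_of_lt_one h0 h1).mul_const _
  rw [zero_mul] at ht
  refine squeeze_zero (fun _ => dist_nonneg) (fun m => ?_) ht
  have := hρ (List.replicate m (S.idx j)) y (S.v j)
  rwa [List.length_replicate, listMap_replicate_v, ← iterate_F] at this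

end PCFFractal

namespace HarmonicStructure

variable {d N n : ℕ} {S : PCFFractal d N n} {H : HarmonicStructure S}

theorem IsHarmonic.F_v {h : EuclideanSpace ℝ (Fin d) → ℝ} (hh : H.IsHarmonic h)
    (j k : Fin (n + 2)) :
    h (S.F (S.idx j) (S.v k)) = Matrix.mulVec (H.M j) (fun l => h (S.v l)) k := by
  have hK : S.F (S.idx j) (S.v k) ∈ S.K := S.F_mem (S.v_mem k)
  rw [← H.harmonicExt_eqOn hh hK, H.harmonicExt_eq_sum _ hK]
  exact Finset.sum_congr rfl fun l _ => mul_comm _ _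

theorem IsHarmonic.iterate_F_v {h : EuclideanSpace ℝ (Fin d) → ℝ} (hh : H.IsHarmonic h)
    (j : Fin (n + 2)) (m : ℕ) (k : Fin (n + 2)) :
    h ((S.F (S.idx j))^[m] (S.v k)) = Matrix.mulVec (H.M j ^ m) (fun l => h (S.v l)) k := by
  induction m generalizing h with
  | zero => simp
  | succ m ih =>
    rw [Function.iterate_succ_apply', ih (hh.comp_F (S.idx j)), pow_succ,
      ← Matrix.mulVec_mulVec, funext fun l => hh.F_v j l]

/-- The normal derivative is a left eigenvector. -/
theorem IsHarmonic.normalVec_F {h : EuclideanSpace ℝ (Fin d) → ℝ} (hh : H.IsHarmonic h)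
    (j : Fin (n + 2)) : ∑ l, H.normalVec j l * h (S.F (S.idx j) (S.v l)) =
      H.r (S.idx j) * ∑ l, H.normalVec j l * h (S.v l) := by
  classical
  -- `v j` is a corner of only one first-level cell, so testing with its indicator leaves a single
  -- term at level one.
  set φ : EuclideanSpace ℝ (Fin d) → ℝ := Pi.single (S.v j) 1 with hφ
  have hB := H.energyBilin_eq (hh.energy_eq 1) φ
  have hv : (fun l => φ (S.v l)) = Pi.single j 1 := by
    ext l
    simp only [hφ, Pi.single_apply, S.v_injective.eq_iff]
  rw [H.energyBilin_succ 0, energyBilin_zero, hv, graphBilin_single,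
    Finset.sum_eq_single (S.idx j)] at hB
  · have hF : (fun l => φ (S.F (S.idx j) (S.v l))) = Pi.single j 1 := by
      ext l
      simp only [hφ, Pi.single_apply]
      congr 1
      refine propext ⟨fun hl => (S.F_v_eq_v hl).2, fun hl => by rw [hl, S.F_idx_v]⟩
    rw [energyBilin_zero, hF, graphBilin_single] at hB
    rw [← hB, mul_inv_cancel_left₀ (H.r_pos _).ne']
  · intro i _ hi
    have hF : ∀ l, φ (S.F i (S.v l)) = 0 := fun l =>
      Pi.single_eq_of_ne (fun hl => hi (S.F_v_eq_v hl).1) _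
    simp [energyBilin_zero, graphBilin, hF]
  · exact fun hj => absurd (Finset.mem_univ _) hj

namespace EigenSystem

variable (B : H.EigenSystem)

/-- Coordinates with respect to the left eigenvectors. -/
theorem exists_coords (j : Fin (n + 2)) (y : Fin (n + 2) → ℝ) :
    ∃ a : Fin (n + 2) → ℝ, ∀ k, ∑ l, B.β j k l * a l = y k := by
  have hu : IsUnit (Matrix.of (B.β j)) :=
    Matrix.linearIndependent_rows_iff_isUnit.mp (B.complete j)
  obtain ⟨a, ha⟩ := Matrix.mulVec_surjective_iff_isUnit.mpr hu y
  exact ⟨a, fun k => congrFun ha k⟩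

theorem eq_of_coords {j : Fin (n + 2)} {a b : Fin (n + 2) → ℝ}
    (h : ∀ k, ∑ l, B.β j k l * a l = ∑ l, B.β j k l * b l) : a = b := by
  have hu : IsUnit (Matrix.of (B.β j)) :=
    Matrix.linearIndependent_rows_iff_isUnit.mp (B.complete j)
  exact Matrix.mulVec_injective_iff_isUnit.mpr hu (funext h)

theorem coord_mulVec (j k : Fin (n + 2)) (a : Fin (n + 2) → ℝ) :
    ∑ l, B.β j k l * Matrix.mulVec (H.M j) a l = B.lam j k * ∑ l, B.β j k l * a l := by
  have h := Matrix.dotProduct_mulVec (B.β j k) (H.M j) a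
  rw [B.eigen, smul_dotProduct] at h
  exact h

theorem coord_mulVec_pow (j k : Fin (n + 2)) (m : ℕ) (a : Fin (n + 2) → ℝ) :
    ∑ l, B.β j k l * Matrix.mulVec (H.M j ^ m) a l = B.lam j k ^ m * ∑ l, B.β j k l * a l := by
  induction m with
  | zero => simp
  | succ m ih =>
    rw [pow_succ', ← Matrix.mulVec_mulVec, coord_mulVec, ih]
    ring

/-- Scaling of the coordinates of a harmonic function towards `v j`. -/
theorem coord_iterate {h : EuclideanSpace ℝ (Fin d) → ℝ} (hh : H.IsHarmonic h)
    (j k : Fin (n + 2)) (m : ℕ) : ∑ l, B.β j k l * h ((S.F (S.idx j))^[m] (S.v l)) =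
      B.lam j k ^ m * ∑ l, B.β j k l * h (S.v l) := by
  simp only [hh.iterate_F_v]
  exact B.coord_mulVec_pow j k m _

/-- The points `F_j^m v_l` converge to `v j`, where the harmonic function with values `a` is
continuous. -/
theorem tendsto_coord (j k : Fin (n + 2)) (a : Fin (n + 2) → ℝ) :
    Tendsto (fun m : ℕ => B.lam j k ^ m * ∑ l, B.β j k l * a l) atTop
      (𝓝 ((∑ l, B.β j k l) * a j)) := by
  obtain ⟨h, hh, h0⟩ := H.exists_isHarmonic a
  obtain rfl : (fun l => h (S.v l)) = a := funext h0
  simp only [← B.coord_iterate hh, Finset.sum_mul]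
  refine tendsto_finsetSum _ fun l _ => Tendsto.const_mul _ ?_
  exact (hh.1 (S.v j) (S.v_mem j)).tendsto.comp (tendsto_nhdsWithin_iff.mpr
    ⟨S.tendsto_iterate_F j _, Eventually.of_forall fun m => S.iterate_F_mem _ m (S.v_mem l)⟩)

theorem coord_of_lam_eq_one {j k : Fin (n + 2)} (h : B.lam j k = 1) (a : Fin (n + 2) → ℝ) :
    ∑ l, B.β j k l * a l = (∑ l, B.β j k l) * a j := by
  have := B.tendsto_coord j k a
  simp only [h, one_pow, one_mul] at this
  exact tendsto_nhds_unique tendsto_const_nhds this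

/-- Applied to the vector dual to `β j k`, the zoom shows that the powers of the eigenvalue
converge. Their successive differences have modulus at least `|λ - 1|`. -/
theorem lam_eq_one_of_one_le {j k : Fin (n + 2)} (h : 1 ≤ |B.lam j k|) : B.lam j k = 1 := by
  obtain ⟨a, ha⟩ := B.exists_coords j (Pi.single k 1)
  have h1 := B.tendsto_coord j k a
  rw [ha k, Pi.single_eq_same] at h1
  simp only [mul_one] at h1
  have h2 := (h1.comp (tendsto_add_atTop_nat 1)).sub h1
  rw [sub_self, tendsto_zero_iff_abs_tendsto_zero] at h2
  have h3 : |B.lam j k - 1| ≤ 0 := by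
    refine ge_of_tendsto' h2 fun m => ?_
    simp only [Function.comp_apply]
    rw [show B.lam j k ^ (m + 1) - B.lam j k ^ m = B.lam j k ^ m * (B.lam j k - 1) by ring,
      abs_mul, abs_pow]
    exact le_mul_of_one_le_left (abs_nonneg _) (one_le_pow₀ h)
  exact sub_eq_zero.mp (abs_nonpos_iff.mp h3)

theorem mulVec_one (j : Fin (n + 2)) : Matrix.mulVec (H.M j) (fun _ => 1) = fun _ => 1 :=
  funext fun k => ((isHarmonic_const (H := H) 1).F_v j k).symm

theorem lam_eq_one_or_sum_eq_zero (j k : Fin (n + 2)) :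
    B.lam j k = 1 ∨ ∑ l, B.β j k l = 0 := by
  have h := B.coord_mulVec j k fun _ => 1
  rw [mulVec_one] at h
  simp only [mul_one] at h
  by_cases hs : ∑ l, B.β j k l = 0
  · exact Or.inr hs
  · exact Or.inl (mul_right_cancel₀ hs (h.symm.trans (one_mul _).symm))

/-- Without the eigenvalue `1`, every coordinate of the constant vector would vanish. The leading
eigenvalue then has modulus at least `1`. -/
theorem lam_zero (j : Fin (n + 2)) : B.lam j 0 = 1 := by
  obtain ⟨k, hk⟩ : ∃ k, B.lam j k = 1 := by
    by_contra! hne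
    have h0 : (fun _ => 1 : Fin (n + 2) → ℝ) = 0 := B.eq_of_coords (j := j) fun k => by
      simpa using (B.lam_eq_one_or_sum_eq_zero j k).resolve_left (hne k)
    exact one_ne_zero (congrFun h0 0)
  refine B.lam_eq_one_of_one_le ?_
  have := B.lam_order j 0 k (Fin.zero_le k)
  rwa [hk, abs_one] at this

theorem coord_zero (j : Fin (n + 2)) (a : Fin (n + 2) → ℝ) :
    ∑ l, B.β j 0 l * a l = (∑ l, B.β j 0 l) * a j :=
  B.coord_of_lam_eq_one (B.lam_zero j) a

theorem sum_β_zero_ne_zero (j : Fin (n + 2)) : ∑ l, B.β j 0 l ≠ 0 := by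
  intro h
  obtain ⟨a, ha⟩ := B.exists_coords j fun _ => 1
  have := ha 0
  rw [coord_zero, h, zero_mul] at this
  exact zero_ne_one this

/-- A coordinate with eigenvalue `1` depends only on the value at `v j`, so a second one would be
proportional to `β j 0`. -/
theorem lam_ne_one (j : Fin (n + 2)) {k : Fin (n + 2)} (hk : k ≠ 0) : B.lam j k ≠ 1 := by
  intro h
  obtain ⟨a, ha⟩ := B.exists_coords j (Pi.single k 1)
  have h0 := ha 0
  have h1 := ha k
  rw [Pi.single_eq_of_ne hk.symm, coord_zero, mul_eq_zero, or_iff_right (B.sum_β_zero_ne_zero j)]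
    at h0
  rw [Pi.single_eq_same, B.coord_of_lam_eq_one h, h0, mul_zero] at h1
  exact zero_ne_one h1

theorem sum_β (j : Fin (n + 2)) {k : Fin (n + 2)} (hk : k ≠ 0) : ∑ l, B.β j k l = 0 :=
  (B.lam_eq_one_or_sum_eq_zero j k).resolve_left (B.lam_ne_one j hk)

theorem lam_one (j : Fin (n + 2)) : B.lam j 1 = H.r (S.idx j) := by
  obtain ⟨h, hh, h0⟩ := H.exists_isHarmonic (Pi.single j 1)
  have h1 := hh.normalVec_F j
  have h2 := B.coord_iterate hh j 1 1
  simp only [Function.iterate_one, pow_one, B.normal] at h2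
  rw [h2] at h1
  refine mul_right_cancel₀ ?_ h1
  simp only [h0, Pi.single_apply, mul_ite, mul_one, mul_zero, Finset.sum_ite_eq',
    Finset.mem_univ, if_true]
  exact (H.normalVec_self_pos j).ne'

theorem lam_one_pos (j : Fin (n + 2)) : 0 < B.lam j 1 := B.lam_one j ▸ H.r_pos _

theorem β_one_self_pos (j : Fin (n + 2)) : 0 < B.β j 1 j := B.normal j j ▸ H.normalVec_self_pos j

/-- Left and right eigenvectors for different eigenvalues are orthogonal, and `β j k` annihilates
constants, so its pairing with `γ = 1 - e_j` is `-(β j k) j`. It remains to exclude that the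
eigenvalue for `k` coincides with `lam j 1`. -/
theorem condA_of_mulVec {j : Fin (n + 2)}
    (h : Matrix.mulVec (H.M j) (fun l => 1 - if j = l then 1 else 0) =
      B.lam j 1 • fun l => 1 - if j = l then 1 else 0) : B.CondA j := by
  set γ : Fin (n + 2) → ℝ := fun l => 1 - if j = l then 1 else 0 with hγ
  have hγ0 : γ j = 0 := by simp [hγ]
  have hγ1 : ∀ l, l ≠ j → γ l = 1 := fun l hl => by simp [hγ, hl.symm]
  have hcoord : ∀ k, k ≠ 0 → ∑ l, B.β j k l * γ l = -B.β j k j := by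
    intro k hk
    simp only [hγ, mul_sub, mul_one, Finset.sum_sub_distrib, B.sum_β j hk]
    simp
  intro k hk
  have hk0 : k ≠ 0 := (Fin.zero_le 1 |>.trans_lt hk).ne'
  have h1 := B.coord_mulVec j k γ
  rw [h] at h1
  simp only [Pi.smul_apply, smul_eq_mul, mul_left_comm _ (B.lam j 1), ← Finset.mul_sum] at h1
  rw [← sub_eq_zero, ← sub_mul, mul_eq_zero] at h1
  rcases h1 with h1 | h1
  swap
  · rw [hcoord k hk0] at h1
    linarith
  exfalso
  rw [sub_eq_zero] at h1
  -- If the eigenvalues coincide, the vector `w` dual to `β j k` is another right eigenvector for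
  -- `lam j 1`. It vanishes at `j` because its coordinate `0` does.
  obtain ⟨w, hw⟩ := B.exists_coords j (Pi.single k 1)
  have hMw : Matrix.mulVec (H.M j) w = B.lam j 1 • w := by
    refine B.eq_of_coords (j := j) fun i => ?_
    simp only [Pi.smul_apply, smul_eq_mul, mul_left_comm _ (B.lam j 1), ← Finset.mul_sum]
    rw [B.coord_mulVec, hw i]
    by_cases hik : i = k
    · rw [hik, h1]
    · rw [Pi.single_eq_of_ne hik, mul_zero, mul_zero]
  have hwj : w j = 0 := by
    have := hw 0
    rwa [coord_zero, Pi.single_eq_of_ne hk0.symm, mul_eq_zero,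
      or_iff_right (B.sum_β_zero_ne_zero j)] at this
  obtain ⟨i, hi, hmin⟩ := Finset.exists_min_image (Finset.univ.erase j) w (by
    obtain ⟨i, hi⟩ := exists_ne j
    exact ⟨i, Finset.mem_erase.mpr ⟨hi, Finset.mem_univ i⟩⟩)
  have hij := Finset.ne_of_mem_erase hi
  -- Subtracting the minimum of `w` off `j` gives a nonnegative eigenvector with a zero at some `i ≠
  -- j`. Its harmonic extension vanishes at `F_j v_i`, outside `V_0`, so the strong minimum
  -- principle gives `u = 0`.
  set u : Fin (n + 2) → ℝ := fun l => w l - w i * γ l with hu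
  have hMu : Matrix.mulVec (H.M j) u = B.lam j 1 • u := by
    have : u = w - w i • γ := rfl
    rw [this, Matrix.mulVec_sub, Matrix.mulVec_smul, hMw, h, smul_sub, smul_comm]
  obtain ⟨g, hg, hgu⟩ := H.exists_isHarmonic u
  have hgF : ∀ l, g (S.F (S.idx j) (S.v l)) = B.lam j 1 * u l := fun l => by
    rw [hg.F_v, funext hgu, hMu, Pi.smul_apply, smul_eq_mul]
  have hu0 : ∀ l, 0 ≤ u l := by
    intro l
    by_cases hl : l = j
    · simp [hu, hl, hwj, hγ0]
    · simp only [hu, hγ1 l hl, mul_one, sub_nonneg]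
      exact hmin l (Finset.mem_erase.mpr ⟨hl, Finset.mem_univ l⟩)
  have hui : u i = 0 := by simp [hu, hγ1 i hij]
  have hzero := H.level_one_eq_zero_of_interior_zero (hg.energy_eq 1)
    (fun l => by rw [hgu]; exact hu0 l) (i := S.idx j) (k := i)
    (fun l hl => by
      obtain ⟨h2, rfl⟩ := S.F_v_eq_v hl
      exact hij (S.idx_injective h2.symm))
    (by rw [hgF, hui, mul_zero])
  have hw2 : ∀ l, w l = w i * γ l := fun l => by
    have := hzero l
    rw [hgF, mul_eq_zero, or_iff_right (B.lam_one_pos j).ne'] at this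
    exact sub_eq_zero.mp this
  -- Now `w` is a multiple of `γ`, and its coordinate `1` is `0` while that of `γ` is not. Hence `w
  -- = 0`, although its coordinate `k` is `1`.
  have h3 := hw 1
  rw [Finset.sum_congr rfl fun l _ => by rw [hw2 l, mul_left_comm], ← Finset.mul_sum] at h3
  rw [hcoord 1 one_ne_zero, Pi.single_eq_of_ne hk.ne, mul_eq_zero, neg_eq_zero,
    or_iff_left (B.β_one_self_pos j).ne'] at h3
  have h4 := hw k
  have h5 : ∀ l, w l = 0 := fun l => by rw [hw2 l, h3, zero_mul]
  simp [h5] at h4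

/-- Conditions (b) and (c) both say that `1 - e_j` is a right eigenvector for `lam j 1`: for (b)
after rescaling, for (c) because `M j` fixes constants and maps `e_j` to its column `j`. -/
theorem condA_of_cond {j : Fin (n + 2)} (h : B.CondA j ∨ B.CondB j ∨ B.CondC j) : B.CondA j := by
  rcases h with h | ⟨α, hα, -, c, hc, hαc⟩ | h
  · exact h
  · refine B.condA_of_mulVec ?_
    have h1 : α = c • fun l => 1 - if j = l then 1 else 0 := funext hαc
    rw [h1, Matrix.mulVec_smul, smul_comm] at hα
    exact smul_right_injective _ hc hα
  · refine B.condA_of_mulVec (funext fun l => ?_)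
    have h1 : (fun l => 1 - if j = l then 1 else 0 : Fin (n + 2) → ℝ) =
        (fun _ => 1) - Pi.single j 1 := by
      ext l
      simp [Pi.single_apply, eq_comm]
    have h2 : B.lam j 1 • (fun l => 1 - if j = l then 1 else 0 : Fin (n + 2) → ℝ) =
        fun l => B.lam j 1 - B.lam j 1 * if j = l then 1 else 0 := by
      ext l
      simp [mul_sub]
    rw [h2, h1, Matrix.mulVec_sub, mulVec_one, Matrix.mulVec_single_one]
    simp only [Pi.sub_apply, Matrix.col_apply, h l]
    ring

end EigenSystem

end HarmonicStructure


/-! ### Gluing and harmonicity on `U_0(x)`. -/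

namespace PCFFractal

variable {d N n : ℕ} {S : PCFFractal d N n} {x : EuclideanSpace ℝ (Fin d)}

theorem isEmbedding_wordMap {m : ℕ} (w : Fin m → Fin N) : IsEmbedding (S.wordMap w) := by
  obtain ⟨ρ, h0, h⟩ := S.listMap_similarity (List.ofFn w)
  refine (AntilipschitzWith.of_le_mul_dist (K := ⟨ρ⁻¹, (inv_pos.mpr h0).le⟩)
    fun y z => ?_).isUniformEmbedding
      (LipschitzWith.of_dist_le_mul (K := ⟨ρ, h0.le⟩) fun y z => (h y z).le).uniformContinuous
    |>.isEmbedding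
  change dist y z ≤ ρ⁻¹ * dist (S.listMap (List.ofFn w) y) (S.listMap (List.ofFn w) z)
  rw [h, inv_mul_cancel_left₀ h0.ne']

theorem mem_U_zero {y : EuclideanSpace ℝ (Fin d)} :
    y ∈ S.U x 0 ↔ ∃ p ∈ S.corners x, ∃ z ∈ S.K, S.wordMap p.1 z = y := by
  simp only [U, Set.mem_iUnion, exists_prop]
  exact Iff.rfl

theorem continuousOn_U_iff {h : EuclideanSpace ℝ (Fin d) → ℝ} :
    ContinuousOn h (S.U x 0) ↔
      ∀ p ∈ S.corners x, ContinuousOn (fun y => h (S.wordMap p.1 y)) S.K := by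
  refine ⟨fun hh p hp => hh.comp (isEmbedding_wordMap p.1).continuous.continuousOn
    fun y hy => mem_U_zero.mpr ⟨p, hp, y, hy, rfl⟩, fun hh => ?_⟩
  have hU : S.U x 0 = ⋃ p : S.corners x, S.wordMap p.1.1 '' S.K := by
    ext y
    simp only [mem_U_zero, Set.mem_iUnion, Subtype.exists, exists_prop]
    exact Iff.rfl
  rw [hU]
  refine (locallyFinite_of_finite _).continuousOn_iUnion (fun p => S.isClosed_cell _) fun p => ?_
  rintro _ ⟨y, hy, rfl⟩
  rw [ContinuousWithinAt, ← (isEmbedding_wordMap p.1.1).map_nhdsWithin_eq, tendsto_map'_iff]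
  exact hh p.1 p.2 y hy

theorem cornerMap_v_self {p : (Fin (S.level x) → Fin N) × Fin (n + 2)} (hp : p ∈ S.corners x)
    (m : ℕ) : S.cornerMap p m (S.v p.2) = x := by
  rw [cornerMap, iterate_F_idx_v]
  exact mem_corners.mp hp

theorem cornerMap_v_eq_iff {p : (Fin (S.level x) → Fin N) × Fin (n + 2)} (hp : p ∈ S.corners x)
    {m : ℕ} {l : Fin (n + 2)} : S.cornerMap p m (S.v l) = x ↔ l = p.2 := by
  refine ⟨fun h => ?_, fun h => h ▸ cornerMap_v_self hp m⟩
  have h1 := wordMap_injective p.1 (h.trans (cornerMap_v_self hp m).symm)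
  exact S.v_injective ((S.F_injective _).iterate m h1)

theorem cornerMap_mem_bdryU {p : (Fin (S.level x) → Fin N) × Fin (n + 2)} (hp : p ∈ S.corners x)
    {m : ℕ} {l : Fin (n + 2)} (h : S.IsJunction x → l ≠ p.2) :
    S.cornerMap p m (S.v l) ∈ S.bdryU x m :=
  ⟨⟨p, hp, l, rfl⟩, fun hx hl => h hx ((cornerMap_v_eq_iff hp).mp hl)⟩

/-- Two functions that agree at the boundary points of `U_m(x)` differ at the boundary points of
the cells of `U_m(x)` only by their difference at `x`. -/
theorem eq_add_single_of_eq_on_bdryU {g h : EuclideanSpace ℝ (Fin d) → ℝ} {m : ℕ}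
    (hgh : ∀ y ∈ S.bdryU x m, g y = h y) {p : (Fin (S.level x) → Fin N) × Fin (n + 2)}
    (hp : p ∈ S.corners x) (l : Fin (n + 2)) : g (S.cornerMap p m (S.v l)) =
      h (S.cornerMap p m (S.v l)) + (g x - h x) * (Pi.single p.2 1 : Fin (n + 2) → ℝ) l := by
  by_cases hl : l = p.2
  · rw [hl, cornerMap_v_self hp, Pi.single_eq_same]
    ring
  · rw [Pi.single_eq_of_ne hl, mul_zero, add_zero]
    exact hgh _ (cornerMap_mem_bdryU hp fun _ => hl)

theorem eq_at_of_not_isJunction {g h : EuclideanSpace ℝ (Fin d) → ℝ} {m : ℕ}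
    (hgh : ∀ y ∈ S.bdryU x m, g y = h y) (hx : x ∈ S.Vstar) (hJ : ¬ S.IsJunction x) :
    g x = h x := by
  obtain ⟨p, hp⟩ := corners_nonempty hx
  have := hgh _ (cornerMap_mem_bdryU hp (l := p.2) fun h => absurd h hJ)
  rwa [cornerMap_v_self hp] at this

end PCFFractal

namespace HarmonicStructure

open PCFFractal

variable {d N n : ℕ} {S : PCFFractal d N n} {H : HarmonicStructure S}
  {x : EuclideanSpace ℝ (Fin d)}

theorem IsHarmonic.congr {h h' : EuclideanSpace ℝ (Fin d) → ℝ} (hh : H.IsHarmonic h)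
    (heq : Set.EqOn h' h S.K) : H.IsHarmonic h' := by
  have he : ∀ m, H.energy m h' = H.energy m h := fun m => by
    have : ∀ (w : Fin m → Fin N) j, h' (S.wordMap w (S.v j)) = h (S.wordMap w (S.v j)) :=
      fun w j => heq (S.listMap_mem _ (S.v_mem j))
    simp only [energy, levelEnergy, this]
  exact H.isHarmonic_iff.mpr ⟨hh.1.congr heq, fun m => by rw [he, he, hh.energy_eq]⟩

theorem rWord_pos {m : ℕ} (w : Fin m → Fin N) : 0 < H.rWord w :=
  Finset.prod_pos fun _ _ => H.r_pos _

/-- Harmonic functions on the cells of `U_0(x)` with the same value at `x` fit together. -/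
theorem exists_glue (a : (Fin (S.level x) → Fin N) × Fin (n + 2) → Fin (n + 2) → ℝ) (t : ℝ)
    (ha : ∀ p ∈ S.corners x, a p p.2 = t) : ∃ g : EuclideanSpace ℝ (Fin d) → ℝ,
      ∀ p ∈ S.corners x, H.IsHarmonic (fun y => g (S.wordMap p.1 y)) ∧
        ∀ l, g (S.wordMap p.1 (S.v l)) = a p l := by
  classical
  let g : EuclideanSpace ℝ (Fin d) → ℝ := fun z =>
    if h : ∃ q : ((Fin (S.level x) → Fin N) × Fin (n + 2)) × EuclideanSpace ℝ (Fin d),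
      q.1 ∈ S.corners x ∧ q.2 ∈ S.K ∧ S.wordMap q.1.1 q.2 = z then
    H.harmonicExt (a h.choose.1) h.choose.2 else 0
  have hg : ∀ p ∈ S.corners x, ∀ y ∈ S.K, g (S.wordMap p.1 y) = H.harmonicExt (a p) y := by
    intro p hp y hy
    have h : ∃ q : ((Fin (S.level x) → Fin N) × Fin (n + 2)) × EuclideanSpace ℝ (Fin d),
      q.1 ∈ S.corners x ∧ q.2 ∈ S.K ∧ S.wordMap q.1.1 q.2 = S.wordMap p.1 y :=
      ⟨(p, y), hp, hy, rfl⟩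
    simp only [g, dif_pos h]
    obtain ⟨hq, hz, hqz⟩ := h.choose_spec
    generalize h.choose = q at hq hz hqz ⊢
    -- The chosen representation does not matter: different cells of `U_0(x)` meet only at `x`,
    -- where all pieces have the value `t`.
    by_cases hqp : q.1 = p
    · rw [hqp] at hqz ⊢
      rw [wordMap_injective p.1 hqz]
    · have h1 := eq_of_mem_two_cells hq hp hqp hz hy hqz
      have h2 := wordMap_injective q.1.1 (h1.trans (mem_corners.mp hq).symm)
      have h3 := wordMap_injective p.1 ((hqz.symm.trans h1).trans (mem_corners.mp hp).symm)
      rw [h2, h3, (H.harmonicExt_spec _).2, (H.harmonicExt_spec _).2, ha _ hq, ha _ hp]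
  refine ⟨g, fun p hp => ⟨(H.harmonicExt_spec (a p)).1.congr (hg p hp), fun l => ?_⟩⟩
  rw [hg p hp _ (S.v_mem l), (H.harmonicExt_spec _).2]

theorem energyU_zero (g : EuclideanSpace ℝ (Fin d) → ℝ) : H.energyU x 0 g =
    ∑ p ∈ S.corners x, (H.rWord p.1)⁻¹ *
      graphForm H.c fun l => g (S.cornerMap p 0 (S.v l)) := by
  simp only [energyU, energy_zero]
  rfl

theorem energyU_zero_le (m : ℕ) (g : EuclideanSpace ℝ (Fin d) → ℝ) :
    H.energyU x 0 g ≤ H.energyU x m g :=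
  Finset.sum_le_sum fun p _ => mul_le_mul_of_nonneg_left (H.energy_zero_le m _)
    (inv_pos.mpr (rWord_pos p.1)).le

theorem energyU_eq {g : EuclideanSpace ℝ (Fin d) → ℝ}
    (hg : ∀ p ∈ S.corners x, H.IsHarmonic (fun y => g (S.wordMap p.1 y))) (m : ℕ) :
    H.energyU x m g = H.energyU x 0 g :=
  Finset.sum_congr rfl fun p hp => by rw [(hg p hp).energy_eq]

/-- The energy of `U_0(x)` after a change of the value at `x`. -/
theorem energyU_zero_add_single {g h : EuclideanSpace ℝ (Fin d) → ℝ} {t : ℝ}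
    (hgh : ∀ p ∈ S.corners x, ∀ l, g (S.cornerMap p 0 (S.v l)) =
      h (S.cornerMap p 0 (S.v l)) + t * (Pi.single p.2 1 : Fin (n + 2) → ℝ) l) :
    H.energyU x 0 g = H.energyU x 0 h +
      2 * t * (∑ p ∈ S.corners x, (H.rWord p.1)⁻¹ *
        ∑ l, H.normalVec p.2 l * h (S.cornerMap p 0 (S.v l))) +
      t ^ 2 * ∑ p ∈ S.corners x, (H.rWord p.1)⁻¹ * graphForm H.c (Pi.single p.2 1) := by
  rw [energyU_zero, energyU_zero, Finset.mul_sum, Finset.mul_sum, ← Finset.sum_add_distrib,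
    ← Finset.sum_add_distrib]
  refine Finset.sum_congr rfl fun p hp => ?_
  rw [funext (hgh p hp), graphForm_add_mul, graphBilin_single]
  ring

/-- A function is harmonic on `U_0(x)` if it is harmonic on each cell and its normal derivatives at
a junction vertex `x` add up to `0`. -/
theorem isHarmonicOnU_iff (hx : x ∈ S.Vstar) {h : EuclideanSpace ℝ (Fin d) → ℝ} :
    H.IsHarmonicOnU x h ↔
      (∀ p ∈ S.corners x, H.IsHarmonic (fun y => h (S.wordMap p.1 y))) ∧
      (S.IsJunction x → ∑ p ∈ S.corners x, (H.rWord p.1)⁻¹ *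
        ∑ l, H.normalVec p.2 l * h (S.wordMap p.1 (S.v l)) = 0) := by
  classical
  constructor
  · rintro ⟨hc, hmin⟩
    constructor
    -- The competitor `g` keeps the corner values of `h` and is harmonic in each cell. Comparison
    -- with it bounds every level energy of `h` by the zeroth one, and equality then holds cell by
    -- cell.
    · obtain ⟨g, hg⟩ := exists_glue (H := H) (x := x) (fun p l => h (S.wordMap p.1 (S.v l))) (h x)
        fun p hp => congrArg h (mem_corners.mp hp)
      have hle : ∀ m, H.energyU x m h ≤ H.energyU x 0 h := by
        intro m
        have h1 : ∀ y ∈ S.bdryU x 0, g y = h y := by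
          rintro _ ⟨⟨p, hp, l, rfl⟩, -⟩
          exact (hg p hp).2 l
        refine (hmin m g h1).trans_eq ?_
        rw [energyU_eq fun p hp => (hg p hp).1]
        refine Finset.sum_congr rfl fun p hp => ?_
        rw [energy_zero, energy_zero, funext (hg p hp).2]
      intro p hp
      refine H.isHarmonic_iff.mpr ⟨continuousOn_U_iff.mp hc p hp, fun m => ?_⟩
      have h2 := (Finset.sum_eq_sum_iff_of_le fun p _ => mul_le_mul_of_nonneg_left
        (H.energy_zero_le m _) (inv_pos.mpr (rWord_pos (H := H) p.1)).le).mp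
          (le_antisymm (energyU_zero_le m h) (hle m)) p hp
      exact (mul_left_cancel₀ (inv_pos.mpr (rWord_pos (H := H) p.1)).ne' h2).symm
    · intro hJ
      -- At a junction `x` is not a boundary point, so its value may be varied alone. The linear
      -- term is the sum of the normal derivatives.
      refine eq_zero_of_quadratic_nonneg (q := ∑ p ∈ S.corners x,
        (H.rWord p.1)⁻¹ * graphForm H.c (Pi.single p.2 1)) fun t => ?_
      have h1 := hmin 0 (fun y => h y + t * (Pi.single x 1 : EuclideanSpace ℝ (Fin d) → ℝ) y)
        fun y hy => by
          rw [Pi.single_eq_of_ne (hy.2 hJ), mul_zero, add_zero]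
      have h2 := energyU_zero_add_single (H := H) (x := x) (h := h) (t := t)
        (g := fun y => h y + t * (Pi.single x 1 : EuclideanSpace ℝ (Fin d) → ℝ) y) fun p hp l => by
          simp only [Pi.single_apply, cornerMap_v_eq_iff hp]
      rw [h2] at h1
      change _ ≤ _ + 2 * t * (∑ p ∈ S.corners x, (H.rWord p.1)⁻¹ *
        ∑ l, H.normalVec p.2 l * h (S.wordMap p.1 (S.v l))) + _ at h1
      linarith
  · rintro ⟨hh, hJ⟩
    refine ⟨continuousOn_U_iff.mpr fun p hp => (hh p hp).1, fun m g hg => ?_⟩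
    rw [energyU_eq hh]
    refine le_trans ?_ (energyU_zero_le m g)
    rw [energyU_zero_add_single fun p hp => eq_add_single_of_eq_on_bdryU hg hp]
    have h1 : 0 ≤ ∑ p ∈ S.corners x, (H.rWord p.1)⁻¹ * graphForm H.c (Pi.single p.2 1) :=
      Finset.sum_nonneg fun p _ =>
        mul_nonneg (inv_pos.mpr (rWord_pos p.1)).le (H.graphForm_nonneg _)
    have h2 : 2 * (g x - h x) * (∑ p ∈ S.corners x, (H.rWord p.1)⁻¹ *
        ∑ l, H.normalVec p.2 l * h (S.cornerMap p 0 (S.v l))) = 0 := by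
      by_cases hxJ : S.IsJunction x
      · exact mul_eq_zero_of_right _ (hJ hxJ)
      · rw [eq_at_of_not_isJunction hg hx hxJ, sub_self, mul_zero, zero_mul]
    rw [h2, add_zero]
    exact le_add_of_nonneg_right (mul_nonneg (sq_nonneg _) h1)

theorem exists_isHarmonicOnU (hx : x ∈ S.Vstar)
    (a : (Fin (S.level x) → Fin N) × Fin (n + 2) → Fin (n + 2) → ℝ) (t : ℝ)
    (ha : ∀ p ∈ S.corners x, a p p.2 = t)
    (hJ : S.IsJunction x → ∑ p ∈ S.corners x, (H.rWord p.1)⁻¹ *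
      ∑ l, H.normalVec p.2 l * a p l = 0) :
    ∃ h, H.IsHarmonicOnU x h ∧ ∀ p ∈ S.corners x, ∀ l, h (S.wordMap p.1 (S.v l)) = a p l := by
  obtain ⟨g, hg⟩ := exists_glue (H := H) a t ha
  refine ⟨g, (isHarmonicOnU_iff hx).mpr ⟨fun p hp => (hg p hp).1, fun h => ?_⟩,
    fun p hp => (hg p hp).2⟩
  rw [← hJ h]
  exact Finset.sum_congr rfl fun p hp => by simp only [(hg p hp).2]

end HarmonicStructure


/-! ### Weak tangents, approximants and their convergence. -/

namespace HarmonicStructure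

open PCFFractal

variable {d N n : ℕ} {S : PCFFractal d N n} {H : HarmonicStructure S}
  {x : EuclideanSpace ℝ (Fin d)}

namespace EigenSystem

variable (B : H.EigenSystem)

/-- Each vector is a fixed linear combination of its coordinates, with the dual basis as
coefficients. -/
theorem tendsto_of_coords {ι : Type*} {F : Filter ι} {j : Fin (n + 2)}
    {a : ι → Fin (n + 2) → ℝ}
    (h : ∀ k, Tendsto (fun i => ∑ l, B.β j k l * a i l) F (𝓝 0)) (l : Fin (n + 2)) :
    Tendsto (fun i => a i l) F (𝓝 0) := by
  choose α hα using fun k => B.exists_coords j (Pi.single k 1)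
  have hy : ∀ (y : Fin (n + 2) → ℝ) k, ∑ l, B.β j k l * ∑ i, y i * α i l = y k := by
    intro y k
    simp only [Finset.mul_sum]
    rw [Finset.sum_comm]
    simp only [mul_left_comm (B.β j k _), ← Finset.mul_sum, hα]
    simp [Pi.single_apply]
  have ha : ∀ i, a i = fun l => ∑ k, (∑ l, B.β j k l * a i l) * α k l :=
    fun i => B.eq_of_coords (j := j) fun k =>
      (hy (fun k => ∑ l, B.β j k l * a i l) k).symm
  have h0 : Tendsto (fun i => ∑ k, (∑ l, B.β j k l * a i l) * α k l) F
      (𝓝 (∑ k, 0 * α k l)) := tendsto_finsetSum _ fun k _ => (h k).mul_const _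
  simp only [zero_mul, Finset.sum_const_zero] at h0
  exact h0.congr fun i => (congrFun (ha i) l).symm

theorem coord_cornerMap {h : EuclideanSpace ℝ (Fin d) → ℝ} {q : ℕ}
    {p : (Fin q → Fin N) × Fin (n + 2)} (hh : H.IsHarmonic fun y => h (S.wordMap p.1 y))
    (k : Fin (n + 2)) (m : ℕ) : ∑ l, B.β p.2 k l * h (S.cornerMap p m (S.v l)) =
      B.lam p.2 k ^ m * ∑ l, B.β p.2 k l * h (S.wordMap p.1 (S.v l)) :=
  B.coord_iterate hh p.2 k m

theorem hasVertexDeriv_of_isHarmonic {h : EuclideanSpace ℝ (Fin d) → ℝ} {q : ℕ}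
    {p : (Fin q → Fin N) × Fin (n + 2)} (hh : H.IsHarmonic fun y => h (S.wordMap p.1 y))
    (k : Fin (n + 2)) : B.HasVertexDeriv h p k
      ((H.rWord p.1)⁻¹ * ∑ l, B.β p.2 k l * h (S.wordMap p.1 (S.v l))) := by
  refine tendsto_const_nhds.congr fun m => ?_
  rw [B.coord_cornerMap hh, mul_assoc,
    inv_mul_cancel_left₀ (pow_ne_zero _ (B.lam_ne_zero _ _))]

/-- Coordinate `0` encodes the value at `x` and the others the gradient, so the corner data can be
prescribed in every cell. The compatibility condition is the one needed for gluing. -/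
theorem exists_isWeakTangent (hx : x ∈ S.Vstar) {f : EuclideanSpace ℝ (Fin d) → ℝ}
    (hf : B.DifferentiableAtVertex f x) : ∃ T, B.IsWeakTangent f x T := by
  obtain ⟨-, D, hD, hDJ⟩ := hf
  choose a ha using fun p : (Fin (S.level x) → Fin N) × Fin (n + 2) => B.exists_coords p.2
    fun k => if k = 0 then (∑ l, B.β p.2 0 l) * f x else H.rWord p.1 * D p k
  have ha0 : ∀ p, a p p.2 = f x := fun p => by
    have h := ha p 0
    rw [coord_zero, if_pos rfl] at h
    exact mul_left_cancel₀ (B.sum_β_zero_ne_zero p.2) h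
  have hak : ∀ p k, k ≠ 0 → (H.rWord p.1)⁻¹ * ∑ l, B.β p.2 k l * a p l = D p k := by
    intro p k hk
    rw [ha, if_neg hk, inv_mul_cancel_left₀ (rWord_pos p.1).ne']
  obtain ⟨T, hT, hTa⟩ := exists_isHarmonicOnU (H := H) hx a (f x) (fun p _ => ha0 p) fun hJ => by
    rw [← hDJ hJ]
    simp only [← B.normal]
    exact Finset.sum_congr rfl fun p _ => hak p 1 one_ne_zero
  refine ⟨T, hT, ?_, D, hD, fun p hp k hk => ?_⟩
  · obtain ⟨p, hp⟩ := corners_nonempty hx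
    have h := hTa p hp p.2
    rwa [mem_corners.mp hp, ha0] at h
  · have h := B.hasVertexDeriv_of_isHarmonic (((isHarmonicOnU_iff hx).mp hT).1 p hp) k
    simp only [hTa p hp] at h
    rwa [hak p k hk] at h

/-- This is the rate at which a change of the value at `x` changes the normal derivative. Positivity
at all corners rules out cancellation between cells. -/
theorem weight_pos (p : (Fin (S.level x) → Fin N) × Fin (n + 2)) (m : ℕ) :
    0 < (H.rWord p.1)⁻¹ * (B.lam p.2 1 ^ m)⁻¹ * B.β p.2 1 p.2 :=
  mul_pos (mul_pos (inv_pos.mpr (rWord_pos p.1)) (inv_pos.mpr (pow_pos (B.lam_one_pos _) m)))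
    (B.β_one_self_pos _)

theorem exists_isApproximant (B : H.EigenSystem) (hx : x ∈ S.Vstar) (f : EuclideanSpace ℝ (Fin d) → ℝ) (m : ℕ) :
    ∃ h, H.IsApproximant f x m h := by
  -- `s` is the change of the value at `x`: zero at a nonjunction vertex, and at a junction the
  -- solution of a linear equation whose coefficient is a sum of positive weights.
  obtain ⟨s, hs0, hs⟩ : ∃ s : ℝ, (¬ S.IsJunction x → s = 0) ∧ (S.IsJunction x →
      ∑ p ∈ S.corners x, ((H.rWord p.1)⁻¹ * (B.lam p.2 1 ^ m)⁻¹ *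
        ∑ l, B.β p.2 1 l * f (S.cornerMap p m (S.v l)) +
          s * ((H.rWord p.1)⁻¹ * (B.lam p.2 1 ^ m)⁻¹ * B.β p.2 1 p.2)) = 0) := by
    by_cases hJ : S.IsJunction x
    · have hW := Finset.sum_pos (fun p (_ : p ∈ S.corners x) => B.weight_pos p m)
        (corners_nonempty hx)
      refine ⟨-(∑ p ∈ S.corners x, (H.rWord p.1)⁻¹ * (B.lam p.2 1 ^ m)⁻¹ *
        ∑ l, B.β p.2 1 l * f (S.cornerMap p m (S.v l))) / ∑ p ∈ S.corners x,
          (H.rWord p.1)⁻¹ * (B.lam p.2 1 ^ m)⁻¹ * B.β p.2 1 p.2, fun h => absurd hJ h,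
        fun _ => ?_⟩
      rw [Finset.sum_add_distrib, ← Finset.mul_sum, div_mul_cancel₀ _ hW.ne', add_neg_cancel]
    · exact ⟨0, fun _ => rfl, fun h => absurd h hJ⟩
  set b : (Fin (S.level x) → Fin N) × Fin (n + 2) → Fin (n + 2) → ℝ := fun p l =>
    f (S.cornerMap p m (S.v l)) + s * (Pi.single p.2 1 : Fin (n + 2) → ℝ) l with hb
  -- Dividing the coordinates by `lam ^ m` inverts the `m`-fold zoom: `a` is the corner data whose
  -- zoom is `b`.
  choose a ha using fun p : (Fin (S.level x) → Fin N) × Fin (n + 2) => B.exists_coords p.2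
    fun k => (B.lam p.2 k ^ m)⁻¹ * ∑ l, B.β p.2 k l * b p l
  have hab : ∀ p, Matrix.mulVec (H.M p.2 ^ m) (a p) = b p := fun p =>
    B.eq_of_coords (j := p.2) fun k => by
      rw [coord_mulVec_pow, ha, mul_inv_cancel_left₀ (pow_ne_zero _ (B.lam_ne_zero _ _))]
  have hbsum : ∀ p, ∑ l, B.β p.2 1 l * b p l =
      ∑ l, B.β p.2 1 l * f (S.cornerMap p m (S.v l)) + s * B.β p.2 1 p.2 := by
    intro p
    simp only [hb, mul_add, Finset.sum_add_distrib, mul_left_comm _ s, ← Finset.mul_sum]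
    simp [Pi.single_apply]
  have ha0 : ∀ p ∈ S.corners x, a p p.2 = f x + s := fun p hp => by
    have h := ha p 0
    rw [coord_zero, lam_zero, one_pow, inv_one, one_mul, coord_zero] at h
    rw [mul_left_cancel₀ (B.sum_β_zero_ne_zero p.2) h, hb]
    simp only [cornerMap_v_self hp, Pi.single_eq_same, mul_one]
  obtain ⟨h, hh, hha⟩ := exists_isHarmonicOnU (H := H) hx a (f x + s) ha0 fun hJ => by
    rw [← hs hJ]
    refine Finset.sum_congr rfl fun p _ => ?_
    simp only [← B.normal]
    rw [ha, hbsum]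
    ring
  refine ⟨h, hh, ?_⟩
  rintro _ ⟨⟨p, hp, l, rfl⟩, hl⟩
  have h1 := (((isHarmonicOnU_iff hx).mp hh).1 p hp).iterate_F_v p.2 m l
  rw [funext (hha p hp), hab] at h1
  refine h1.trans ?_
  simp only [hb]
  by_cases hlp : l = p.2
  · have hJ : ¬ S.IsJunction x := fun hJ => hl hJ (by rw [hlp, cornerMap_v_self hp])
    rw [hs0 hJ, zero_mul, add_zero]
  · rw [Pi.single_eq_of_ne hlp, mul_zero, add_zero]

/-- The derivatives of the approximant of `f` are the difference quotients of `f`, up to the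
contribution of the change of the value at `x`. -/
theorem coord_approximant (hx : x ∈ S.Vstar) {f h : EuclideanSpace ℝ (Fin d) → ℝ} {m : ℕ}
    (hh : H.IsApproximant f x m h) {p : (Fin (S.level x) → Fin N) × Fin (n + 2)}
    (hp : p ∈ S.corners x) (k : Fin (n + 2)) :
    (H.rWord p.1)⁻¹ * ∑ l, B.β p.2 k l * h (S.wordMap p.1 (S.v l)) =
      (H.rWord p.1)⁻¹ * (B.lam p.2 k ^ m)⁻¹ * ∑ l, B.β p.2 k l * f (S.cornerMap p m (S.v l)) +
        (h x - f x) * ((H.rWord p.1)⁻¹ * (B.lam p.2 k ^ m)⁻¹ * B.β p.2 k p.2) := by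
  have h1 := B.coord_cornerMap (((isHarmonicOnU_iff hx).mp hh.1).1 p hp) k m
  simp only [eq_add_single_of_eq_on_bdryU hh.2 hp, mul_add, Finset.sum_add_distrib,
    mul_left_comm _ (h x - f x), ← Finset.mul_sum] at h1
  rw [← inv_mul_cancel_left₀ (pow_ne_zero m (B.lam_ne_zero p.2 k))
    (∑ l, B.β p.2 k l * h (S.wordMap p.1 (S.v l))), ← h1]
  simp only [Pi.single_apply, mul_ite, mul_one, mul_zero, Finset.sum_ite_eq', Finset.mem_univ,
    if_true]
  ring

/-- The change of the value at `x` is of smaller order than the normal scaling. -/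
theorem tendsto_change_mul_weight (hx : x ∈ S.Vstar) {f : EuclideanSpace ℝ (Fin d) → ℝ}
    (hf : B.DifferentiableAtVertex f x) {h : ℕ → EuclideanSpace ℝ (Fin d) → ℝ}
    (hh : ∀ m, H.IsApproximant f x m (h m)) {p : (Fin (S.level x) → Fin N) × Fin (n + 2)}
    (hp : p ∈ S.corners x) : Tendsto (fun m => (h m x - f x) *
      ((H.rWord p.1)⁻¹ * (B.lam p.2 1 ^ m)⁻¹ * B.β p.2 1 p.2)) atTop (𝓝 0) := by
  by_cases hJ : S.IsJunction x
  swap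
  · simp only [fun m => eq_at_of_not_isJunction (hh m).2 hx hJ, sub_self, zero_mul]
    exact tendsto_const_nhds
  obtain ⟨-, D, hD, hDJ⟩ := hf
  have h1 : Tendsto (fun m => ∑ p ∈ S.corners x, (H.rWord p.1)⁻¹ * (B.lam p.2 1 ^ m)⁻¹ *
      ∑ l, B.β p.2 1 l * f (S.cornerMap p m (S.v l))) atTop (𝓝 0) :=
    hDJ hJ ▸ tendsto_finsetSum _ fun p hp => hD p hp 1 one_ne_zero
  have h0 := h1.norm
  rw [norm_zero] at h0
  refine squeeze_zero_norm (fun m => ?_) h0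
  have h2 := ((isHarmonicOnU_iff hx).mp (hh m).1).2 hJ
  simp only [← B.normal] at h2
  rw [Finset.sum_congr rfl fun p hp => B.coord_approximant hx (hh m) hp 1,
    Finset.sum_add_distrib, ← Finset.mul_sum] at h2
  -- The normal derivatives of `h m` cancel, so the sum of the quotients of `f` is minus the change
  -- at `x` times the total weight. That total is at least each single weight.
  rw [eq_neg_of_add_eq_zero_left h2, norm_neg, norm_mul (h m x - f x),
    norm_mul (h m x - f x)]
  refine mul_le_mul_of_nonneg_left ?_ (norm_nonneg _)
  have h3 := Finset.single_le_sum (fun p _ => (B.weight_pos (x := x) p m).le) hp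
  rw [Real.norm_of_nonneg (B.weight_pos p m).le]
  exact h3.trans (le_abs_self _)

/-- The values of the approximants at the boundary points of `U_0(x)` converge. -/
theorem tendsto_approximant (hx : x ∈ S.Vstar) (hA : ∀ j, B.CondA j)
    {f : EuclideanSpace ℝ (Fin d) → ℝ} (hf : B.DifferentiableAtVertex f x)
    {T : EuclideanSpace ℝ (Fin d) → ℝ} (hT : B.IsWeakTangent f x T)
    {h : ℕ → EuclideanSpace ℝ (Fin d) → ℝ} (hh : ∀ m, H.IsApproximant f x m (h m))
    {p : (Fin (S.level x) → Fin N) × Fin (n + 2)} (hp : p ∈ S.corners x) (l : Fin (n + 2)) :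
    Tendsto (fun m => h m (S.wordMap p.1 (S.v l)) - T (S.wordMap p.1 (S.v l))) atTop (𝓝 0) := by
  obtain ⟨hTh, hTx, D, hD, hDT⟩ := hT
  have hr := rWord_pos (H := H) p.1
  have hw := B.tendsto_change_mul_weight hx hf hh hp
  have hTp := ((isHarmonicOnU_iff hx).mp hTh).1 p hp
  refine B.tendsto_of_coords (j := p.2)
    (a := fun m l => h m (S.wordMap p.1 (S.v l)) - T (S.wordMap p.1 (S.v l))) (fun k => ?_) l
  simp only [mul_sub, Finset.sum_sub_distrib]
  by_cases hk : k = 0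
  · subst hk
    have h0 : ∀ g : EuclideanSpace ℝ (Fin d) → ℝ, ∑ l, B.β p.2 0 l * g (S.wordMap p.1 (S.v l)) =
        (∑ l, B.β p.2 0 l) * g x := fun g => by
      rw [B.coord_zero p.2 fun l => g (S.wordMap p.1 (S.v l)), mem_corners.mp hp]
    simp only [h0, hTx, ← mul_sub]
    rw [← mul_zero (∑ l, B.β p.2 0 l)]
    refine Tendsto.const_mul _ ?_
    have hβ := B.β_one_self_pos p.2
    have hw' := hw.norm
    rw [norm_zero] at hw'
    refine squeeze_zero_norm (fun m => ?_)
      (mul_zero (H.rWord p.1 * (B.β p.2 1 p.2)⁻¹) ▸ hw'.const_mul (H.rWord p.1 * (B.β p.2 1 p.2)⁻¹))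
    -- Since `lam p.2 1 = r < 1`, the weights stay away from `0`, so the change at `x` itself tends
    -- to `0`.
    have h1 : 1 ≤ (B.lam p.2 1 ^ m)⁻¹ := (one_le_inv₀ (pow_pos (B.lam_one_pos _) m)).mpr
      (pow_le_one₀ (B.lam_one_pos _).le (B.lam_one p.2 ▸ (H.r_lt_one _).le))
    rw [norm_mul, Real.norm_of_nonneg (B.weight_pos p m).le]
    calc ‖h m x - f x‖ = ‖h m x - f x‖ * 1 := (mul_one _).symm
      _ ≤ ‖h m x - f x‖ * (B.lam p.2 1 ^ m)⁻¹ := mul_le_mul_of_nonneg_left h1 (norm_nonneg _)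
      _ = _ := by field_simp
  · have h1 : ∑ l, B.β p.2 k l * T (S.wordMap p.1 (S.v l)) = H.rWord p.1 * D p k := by
      rw [← tendsto_nhds_unique (B.hasVertexDeriv_of_isHarmonic hTp k) (hDT p hp k hk),
        mul_inv_cancel_left₀ hr.ne']
    have h2 := fun m => (mul_inv_cancel_left₀ hr.ne' _).symm.trans
      (congrArg (H.rWord p.1 * ·) (B.coord_approximant hx (hh m) hp k))
    simp only [h1, h2, ← mul_sub]
    rw [← mul_zero (H.rWord p.1)]
    refine Tendsto.const_mul _ ?_
    rw [show (0 : ℝ) = D p k + 0 - D p k by ring]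
    refine ((hD p hp k hk).add ?_).sub_const _
    by_cases hk1 : k = 1
    · rw [hk1]
      exact hw
    -- For `k ≥ 2` the scaling `λ^{-m}` may outgrow the decay of the change at `x`. Condition (a)
    -- makes the coefficient vanish.
    · have : B.β p.2 k p.2 = 0 := hA p.2 k (lt_of_le_of_ne (Fin.one_le_of_ne_zero hk) (Ne.symm hk1))
      simp only [this, mul_zero]
      exact tendsto_const_nhds

/-- On each cell `h m - T` is harmonic, hence bounded by the sum of its absolute corner values, and
there are finitely many corners. -/
theorem tendstoUniformlyOn_approximant (hx : x ∈ S.Vstar) (hA : ∀ j, B.CondA j)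
    {f : EuclideanSpace ℝ (Fin d) → ℝ} (hf : B.DifferentiableAtVertex f x)
    {T : EuclideanSpace ℝ (Fin d) → ℝ} (hT : B.IsWeakTangent f x T)
    {h : ℕ → EuclideanSpace ℝ (Fin d) → ℝ} (hh : ∀ m, H.IsApproximant f x m (h m)) :
    TendstoUniformlyOn h T atTop (S.U x 0) := by
  have h0 : Tendsto (fun m => ∑ p ∈ S.corners x,
      ∑ l, |h m (S.wordMap p.1 (S.v l)) - T (S.wordMap p.1 (S.v l))|) atTop
      (𝓝 (∑ p ∈ S.corners x, ∑ l : Fin (n + 2), 0)) :=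
    tendsto_finsetSum _ fun p hp => tendsto_finsetSum _ fun l _ =>
      (tendsto_zero_iff_abs_tendsto_zero _).mp (B.tendsto_approximant hx hA hf hT hh hp l)
  simp only [Finset.sum_const_zero] at h0
  rw [Metric.tendstoUniformlyOn_iff]
  intro ε hε
  filter_upwards [h0.eventually (gt_mem_nhds hε)] with m hm y hy
  obtain ⟨p, hp, z, hz, rfl⟩ := mem_U_zero.mp hy
  refine lt_of_le_of_lt ?_ hm
  have h1 := (((isHarmonicOnU_iff hx).mp (hh m).1).1 p hp).add_mul
    (((isHarmonicOnU_iff hx).mp hT.1).1 p hp) (-1)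
  simp only [neg_mul, one_mul, ← sub_eq_add_neg] at h1
  rw [dist_comm, Real.dist_eq]
  have h2 := H.abs_harmonicExt_le
    (fun l => h m (S.wordMap p.1 (S.v l)) - T (S.wordMap p.1 (S.v l))) hz
  rw [H.harmonicExt_eqOn h1 hz] at h2
  exact h2.trans (Finset.single_le_sum (f := fun p : (Fin (S.level x) → Fin N) × Fin (n + 2) =>
    ∑ l, |h m (S.wordMap p.1 (S.v l)) - T (S.wordMap p.1 (S.v l))|)
    (fun p _ => Finset.sum_nonneg fun l _ => abs_nonneg _) hp)

end EigenSystem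

end HarmonicStructure

end

theorem theorem5p2 {d N n : ℕ} (S : PCFFractal d N n) (H : HarmonicStructure S)
    (B : H.EigenSystem)
    (hcond : ∀ j, B.CondA j ∨ B.CondB j ∨ B.CondC j)
    (x : EuclideanSpace ℝ (Fin d)) (hx : x ∈ S.Vstar)
    (f : EuclideanSpace ℝ (Fin d) → ℝ) (hf : B.DifferentiableAtVertex f x) :
    (∃ T, B.IsWeakTangent f x T) ∧
    (∀ m, ∃ h, H.IsApproximant f x m h) ∧
    ∀ (T : EuclideanSpace ℝ (Fin d) → ℝ) (h : ℕ → EuclideanSpace ℝ (Fin d) → ℝ),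
      B.IsWeakTangent f x T → (∀ m, H.IsApproximant f x m (h m)) →
      TendstoUniformlyOn h T Filter.atTop (S.U x 0) := by
  have hA : ∀ j, B.CondA j := fun j => B.condA_of_cond (hcond j)
  exact ⟨B.exists_isWeakTangent hx hf, B.exists_isApproximant hx f,
    fun T h hT hh => B.tendstoUniformlyOn_approximant hx hA hf hT hh⟩
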